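/- **Theorem 1.3.** For every integer $n\ge 2$ there is a non-compact, forward complete, simply connected $n$-dimensional Finsler manifold $(M,F)$ with constant negative flag curvature such that $$\lambda_{1,d_F}(M)=0 .$$ Moreover, one such manifold is the Euclidean open unit ball $B^n=\{x\in\mathbb R^n:|x|<1\}$ endowed with the Funk metric $$F(x,y)=\frac{\sqrt{|y|^2-(|x|^2|y|^2-\langle x,y\rangle^2)}}{1-|x|^2}+\frac{\langle x,y\rangle}{1-|x|^2},\qquad x\in B^n,\ y\in T_xB^n=\mathbb R^n,$$ whose flag curvature is constant, equal to $-\tfrac14$. Here a Finsler manifold is a connected smooth manifold $M$ with a continuous function $F:TM\to[0,\infty)$ that is $C^\infty$ on $TM\setminus\{0\}$, satisfies $F(x,ty)=tF(x,y)$ for $t\ge 0$, and has positive definite fundamental tensor $g_v=\big(\tfrac12F^2\big)_{y^iy^j}(v)$ for all $v\in TM\setminus\{0\}$. The flag curvature is $$\mathbf K(\mathrm{span}\{u,v\};v)=\frac{g_v(R(u,v)v,u)}{g_v(v,v)g_v(u,u)-g_v(u,v)^2}$$ with the curvature tensor $R$ of the Chern connection taken at the reference vector $v$. Forward complete means that every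 geodesic segment $[0,a]\to M$ extends to a geodesic $[0,\infty)\to M$. The distance $d_F(x_1,x_2)$ is the infimum of the lengths $\int_0^r F(\sigma,\dot\sigma)\,dt$ of piecewise smooth curves $\sigma:[0,r]\to M$ from $x_1$ to $x_2$. Finally, $$\lambda_{1,d_F}(M)=\inf_{u\in \mathrm{Lip}_0(M)\setminus\{0\}}\frac{\int_M|\nabla u|_{d_F}^2\,dv_F}{\int_M u^2\,dv_F},\qquad |\nabla u|_{d_F}(x)=\limsup_{y\to x}\frac{u(y)-u(x)}{d_F(x,y)},$$ where $\mathrm{Lip}_0(M)$ is the set of compactly supported functions on $M$ that are Lipschitz with respect to $d_F$, and $v_F$ is the Busemann-Hausdorff measure, given in local coordinates by $\frac{\omega_n}{|\{y:F(x,y)<1\}|}\,dx$, with $\omega_n$ the volume of the Euclidean unit ball of $\mathbb R^n$. -/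

import Mathlib

open scoped Manifold ContDiff Topology ENNReal

namespace Finsler

noncomputable section

/-! ## Finsler geometry in local coordinates

Here `L x y` is a Finsler function written in coordinates: `x` is the base point and `y` the
coordinate vector of the tangent vector. -/

section Coordinates

variable {n : ℕ}

/-- The partial derivative `∂f/∂xᵏ` of a function of `(x, y)`. -/
def dX (k : Fin n) (f : EuclideanSpace ℝ (Fin n) → EuclideanSpace ℝ (Fin n) → ℝ)
    (x y : EuclideanSpace ℝ (Fin n)) : ℝ :=
  fderiv ℝ (fun z => f z y) x (EuclideanSpace.single k 1)

/-- The partial derivative `∂f/∂yᵏ` of a function of `(x, y)`. -/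
def dY (k : Fin n) (f : EuclideanSpace ℝ (Fin n) → EuclideanSpace ℝ (Fin n) → ℝ)
    (x y : EuclideanSpace ℝ (Fin n)) : ℝ :=
  fderiv ℝ (fun z => f x z) y (EuclideanSpace.single k 1)

/-- The components `g_ij = (½ L²)_{yⁱ yʲ}` of the fundamental tensor. -/
def fundTensor (L : EuclideanSpace ℝ (Fin n) → EuclideanSpace ℝ (Fin n) → ℝ)
    (i j : Fin n) : EuclideanSpace ℝ (Fin n) → EuclideanSpace ℝ (Fin n) → ℝ :=
  dY j (dY i (fun x y => (1 / 2) * L x y ^ 2))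

/-- The bilinear form `g_y(u, w) = g_ij(x, y) uⁱ wʲ`. -/
def fundForm (L : EuclideanSpace ℝ (Fin n) → EuclideanSpace ℝ (Fin n) → ℝ)
    (x y u w : EuclideanSpace ℝ (Fin n)) : ℝ :=
  ∑ i, ∑ j, fundTensor L i j x y * u i * w j

/-- The components `gⁱʲ` of the inverse of the fundamental tensor. -/
def fundInv (L : EuclideanSpace ℝ (Fin n) → EuclideanSpace ℝ (Fin n) → ℝ)
    (i j : Fin n) (x y : EuclideanSpace ℝ (Fin n)) : ℝ :=
  (Matrix.of fun a b => fundTensor L a b x y)⁻¹ i j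

/-- The geodesic coefficients `Gⁱ = ¼ gⁱˡ ((L²)_{xᵏ yˡ} yᵏ - (L²)_{xˡ})`. -/
def sprayCoeff (L : EuclideanSpace ℝ (Fin n) → EuclideanSpace ℝ (Fin n) → ℝ)
    (i : Fin n) (x y : EuclideanSpace ℝ (Fin n)) : ℝ :=
  (1 / 4) * ∑ l, fundInv L i l x y *
    ((∑ k, dX k (dY l (fun x y => L x y ^ 2)) x y * y k) - dX l (fun x y => L x y ^ 2) x y)

/-- The nonlinear connection `Nⁱ_j = ∂Gⁱ/∂yʲ`. -/
def nonlinConn (L : EuclideanSpace ℝ (Fin n) → EuclideanSpace ℝ (Fin n) → ℝ)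
    (i j : Fin n) : EuclideanSpace ℝ (Fin n) → EuclideanSpace ℝ (Fin n) → ℝ :=
  dY j (sprayCoeff L i)

/-- The horizontal derivative `δf/δxᵏ = ∂f/∂xᵏ - Nᵐ_k ∂f/∂yᵐ`. -/
def horizDeriv (L : EuclideanSpace ℝ (Fin n) → EuclideanSpace ℝ (Fin n) → ℝ) (k : Fin n)
    (f : EuclideanSpace ℝ (Fin n) → EuclideanSpace ℝ (Fin n) → ℝ)
    (x y : EuclideanSpace ℝ (Fin n)) : ℝ :=
  dX k f x y - ∑ m, nonlinConn L m k x y * dY m f x y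

/-- The coefficients of the Chern connection,
`Γⁱ_jk = ½ gⁱˢ (δg_sj/δxᵏ - δg_jk/δxˢ + δg_ks/δxʲ)`. -/
def chernCoeff (L : EuclideanSpace ℝ (Fin n) → EuclideanSpace ℝ (Fin n) → ℝ)
    (i j k : Fin n) (x y : EuclideanSpace ℝ (Fin n)) : ℝ :=
  (1 / 2) * ∑ s, fundInv L i s x y *
    (horizDeriv L k (fundTensor L s j) x y - horizDeriv L s (fundTensor L j k) x y
      + horizDeriv L j (fundTensor L k s) x y)

/-- The (horizontal) curvature tensor of the Chern connection,
`R_jⁱ_kl = δΓⁱ_jl/δxᵏ - δΓⁱ_jk/δxˡ + Γⁱ_hk Γʰ_jl - Γⁱ_hl Γʰ_jk`. -/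
def chernCurv (L : EuclideanSpace ℝ (Fin n) → EuclideanSpace ℝ (Fin n) → ℝ)
    (j i k l : Fin n) (x y : EuclideanSpace ℝ (Fin n)) : ℝ :=
  horizDeriv L k (chernCoeff L i j l) x y - horizDeriv L l (chernCoeff L i j k) x y
    + ∑ h, (chernCoeff L i h k x y * chernCoeff L h j l x y
      - chernCoeff L i h l x y * chernCoeff L h j k x y)

/-- The vector `R(u, v)v`, with components `vʲ R_jⁱ_kl uᵏ vˡ`, where the curvature tensor is taken
at the reference vector `v`. -/
def curvVec (L : EuclideanSpace ℝ (Fin n) → EuclideanSpace ℝ (Fin n) → ℝ)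
    (x v u : EuclideanSpace ℝ (Fin n)) : EuclideanSpace ℝ (Fin n) :=
  WithLp.toLp 2 fun i => ∑ j, ∑ k, ∑ l, v j * chernCurv L j i k l x v * u k * v l

/-- The flag curvature `g_v(R(u,v)v, u) / (g_v(v,v) g_v(u,u) - g_v(u,v)²)` of the flag with pole `v`
spanned by `u` and `v`. -/
def localFlagCurv (L : EuclideanSpace ℝ (Fin n) → EuclideanSpace ℝ (Fin n) → ℝ)
    (x v u : EuclideanSpace ℝ (Fin n)) : ℝ :=
  fundForm L x v (curvVec L x v u) u /
    (fundForm L x v v v * fundForm L x v u u - fundForm L x v u v ^ 2)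

end Coordinates

/-! ## Finsler manifolds -/

section Manifolds

variable {n : ℕ} {M : Type*} [TopologicalSpace M] [ChartedSpace (EuclideanSpace ℝ (Fin n)) M]

/-- The function `F` on the tangent bundle, written in the preferred chart at `p` and the frame of
coordinate vector fields of this chart. -/
def chartRep (F : TangentBundle (𝓡 n) M → ℝ) (p : M)
    (x y : EuclideanSpace ℝ (Fin n)) : ℝ :=
  F ⟨(extChartAt (𝓡 n) p).symm x,
    mfderiv 𝓘(ℝ, EuclideanSpace ℝ (Fin n)) (𝓡 n) (extChartAt (𝓡 n) p).symm x y⟩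

/-- `F` is a Finsler structure on the smooth manifold `M`. In the last field the fundamental tensor
at `v ∈ T_pM` is computed in the preferred chart at `p`. -/
structure IsFinslerMetric [IsManifold (𝓡 n) ∞ M] (F : TangentBundle (𝓡 n) M → ℝ) : Prop where
  continuous : Continuous F
  nonneg : ∀ v, 0 ≤ F v
  smooth : ContMDiffOn (𝓡 n).tangent 𝓘(ℝ, ℝ) ∞ F {v | v.2 ≠ 0}
  homogeneous : ∀ (p : M) (v : TangentSpace (𝓡 n) p) (t : ℝ), 0 ≤ t → F ⟨p, t • v⟩ = t * F ⟨p, v⟩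
  posDef : ∀ (p : M) (v u : EuclideanSpace ℝ (Fin n)), v ≠ 0 → u ≠ 0 →
    0 < fundForm (chartRep F p) (extChartAt (𝓡 n) p p) v u u

/-- All flags of `(M, F)` have flag curvature `K`; for the point `p`, the flag curvature is computed
in the preferred chart at `p`. -/
def HasConstantFlagCurvature (F : TangentBundle (𝓡 n) M → ℝ) (K : ℝ) : Prop :=
  ∀ (p : M) (v u : EuclideanSpace ℝ (Fin n)), LinearIndependent ℝ ![v, u] →
    localFlagCurv (chartRep F p) (extChartAt (𝓡 n) p p) v u = K

/-- The restriction of `σ` to the interval `S` is a geodesic of `F`: a smooth curve which satisfies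
`σ̈ⁱ + Γⁱ_jk(σ, σ̇) σ̇ʲ σ̇ᵏ = 0` in coordinates (with one-sided derivatives at end points of `S`
that belong to `S`). -/
def IsGeodesicOn (F : TangentBundle (𝓡 n) M → ℝ) (σ : ℝ → M) (S : Set ℝ) : Prop :=
  ContMDiffOn 𝓘(ℝ, ℝ) (𝓡 n) ∞ σ S ∧
  ∀ p : M, ∀ t ∈ S, σ t ∈ (extChartAt (𝓡 n) p).source → ∀ i : Fin n,
    let c : ℝ → EuclideanSpace ℝ (Fin n) := fun s => extChartAt (𝓡 n) p (σ s)
    let c' : ℝ → EuclideanSpace ℝ (Fin n) := derivWithin c S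
    derivWithin c' S t i
      + ∑ j, ∑ k, chernCoeff (chartRep F p) i j k (c t) (c' t) * c' t j * c' t k = 0

/-- Every geodesic segment `[0, a] → M` extends to a geodesic `[0, ∞) → M`. -/
def ForwardComplete (F : TangentBundle (𝓡 n) M → ℝ) : Prop :=
  ∀ (a : ℝ) (σ : ℝ → M), 0 < a → IsGeodesicOn F σ (Set.Icc 0 a) →
    ∃ τ : ℝ → M, IsGeodesicOn F τ (Set.Ici 0) ∧ Set.EqOn τ σ (Set.Icc 0 a)

/-- `σ : [0, r] → M` is a piecewise smooth curve: `[0, r]` can be subdivided into finitely many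
closed intervals on each of which `σ` is smooth. -/
def IsPiecewiseSmooth (n : ℕ) {M : Type*} [TopologicalSpace M]
    [ChartedSpace (EuclideanSpace ℝ (Fin n)) M] (σ : ℝ → M) (r : ℝ) : Prop :=
  ∃ (k : ℕ) (t : ℕ → ℝ), Monotone t ∧ t 0 = 0 ∧ t k = r ∧
    ∀ i < k, ContMDiffOn 𝓘(ℝ, ℝ) (𝓡 n) ∞ σ (Set.Icc (t i) (t (i + 1)))

/-- The integral length of a curve `σ : [0, r] → M`. -/
def curveLength (F : TangentBundle (𝓡 n) M → ℝ) (σ : ℝ → M) (r : ℝ) : ℝ :=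
  ∫ t in (0 : ℝ)..r, F ⟨σ t, mfderiv 𝓘(ℝ, ℝ) (𝓡 n) σ t (1 : ℝ)⟩

/-- The (in general non-symmetric) distance function `d_F` of a connected Finsler manifold. -/
def finslerDist (F : TangentBundle (𝓡 n) M → ℝ) (x y : M) : ℝ :=
  sInf {ℓ : ℝ | ∃ (σ : ℝ → M) (r : ℝ), IsPiecewiseSmooth n σ r ∧ σ 0 = x ∧ σ r = y ∧
    ℓ = curveLength F σ r}

/-- The density `σ_F(x) = ω_n / vol {y | F(x, y) < 1}` in the preferred chart at `p`. -/
def bhDensity (F : TangentBundle (𝓡 n) M → ℝ) (p : M) (x : EuclideanSpace ℝ (Fin n)) : ℝ≥0∞ :=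
  MeasureTheory.volume (Metric.ball (0 : EuclideanSpace ℝ (Fin n)) 1) /
    MeasureTheory.volume {y : EuclideanSpace ℝ (Fin n) | chartRep F p x y < 1}

/-- The Busemann-Hausdorff measure: the measure which is `σ_F(x) dx` in coordinates. The measures
`σ_F(x) dx` on the various chart domains agree on overlaps, so that the measure which restricts to
all of them is their supremum. -/
def bhMeasure [MeasurableSpace M] (F : TangentBundle (𝓡 n) M → ℝ) : MeasureTheory.Measure M :=
  ⨆ p : M, MeasureTheory.Measure.map (extChartAt (𝓡 n) p).symm
    ((MeasureTheory.volume.restrict (extChartAt (𝓡 n) p).target).withDensity (bhDensity F p))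

end Manifolds

/-! ## The first eigenvalue of a quasi-metric measure space -/

section Eigenvalue

variable {M : Type*} [TopologicalSpace M]

/-- The local slope `limsup_{y → x} (u y - u x) / d(x, y)`. -/
def slopeAt (d : M → M → ℝ) (u : M → ℝ) (x : M) : ℝ :=
  Filter.limsup (fun y => (u y - u x) / d x y) (𝓝[≠] x)

/-- Lipschitz functions with compact support. -/
def IsLipZero (d : M → M → ℝ) (u : M → ℝ) : Prop :=
  (∃ C : ℝ, ∀ x y, |u x - u y| ≤ C * d x y) ∧ HasCompactSupport u

/-- The fundamental frequency of `(M, d, μ)`: the infimum of the Rayleigh quotients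
`∫ |∇u|² dμ / ∫ u² dμ` over the non-zero Lipschitz functions `u` with compact support. -/
def firstEigenvalue [MeasurableSpace M] (d : M → M → ℝ) (μ : MeasureTheory.Measure M) : ℝ≥0∞ :=
  ⨅ (u : M → ℝ) (_ : IsLipZero d u) (_ : u ≠ 0),
    (∫⁻ x, ENNReal.ofReal (slopeAt d u x ^ 2) ∂μ) / (∫⁻ x, ENNReal.ofReal (u x ^ 2) ∂μ)

end Eigenvalue

/-! ## The Funk metric -/

/-- The Euclidean open unit ball `Bⁿ`, an open submanifold of `ℝⁿ`. -/
def unitBall (n : ℕ) : TopologicalSpace.Opens (EuclideanSpace ℝ (Fin n)) :=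
  ⟨Metric.ball 0 1, Metric.isOpen_ball⟩

/-- The Funk metric in the coordinates of `ℝⁿ`. -/
def funkNorm {n : ℕ} (x y : EuclideanSpace ℝ (Fin n)) : ℝ :=
  √(‖y‖ ^ 2 - (‖x‖ ^ 2 * ‖y‖ ^ 2 - inner ℝ x y ^ 2)) / (1 - ‖x‖ ^ 2)
    + inner ℝ x y / (1 - ‖x‖ ^ 2)

/-- The Funk metric on the unit ball; the tangent spaces are identified with `ℝⁿ` by the derivative
of the inclusion into `ℝⁿ`. -/
def funkMetric (n : ℕ) (v : TangentBundle (𝓡 n) (unitBall n)) : ℝ :=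
  funkNorm (v.1 : EuclideanSpace ℝ (Fin n))
    (mfderiv (𝓡 n) 𝓘(ℝ, EuclideanSpace ℝ (Fin n))
      (Subtype.val : unitBall n → EuclideanSpace ℝ (Fin n)) v.1 v.2)

end

end Finsler

/-! The Funk norm is the Minkowski functional of the ball as seen from `x`: `F(x, y)` is the unique
`t ≥ 0` with `‖t x + y‖ = t` (`eq_funkNorm`), so for `y ≠ 0` the point `x + y / F` lies on the unit
sphere. Implicit differentiation of the resulting quadratic gives Okada's equation `F_{xᵏ} = F
F_{yᵏ}` (`isFunkType_funkNorm`).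

Okada's equation, homogeneity and convexity determine the curvature. The spray is `G = F y / 2`,
hence `Nⁱ_k = (F δⁱ_k + F_{yᵏ} yⁱ) / 2`. The horizontal derivative of the fundamental tensor is
totally symmetric, so contracting the Chern curvature with the reference vector reduces to the
curvature of `N`. This yields `R(u, v)v = (F / 4) (F_y(u) v - F u)` and flag curvature `-1/4`
(`localFlagCurv_eq`).

The geodesic equation becomes `c̈ = -F(c, ċ) ċ`. Speed is conserved, so a nonconstant geodesic is `x
+ ((1 - e^{-lt}) / l) v` with `l = F(x, v)`. It runs along a segment towards the boundary point `x +
v / l`, which it never reaches, so it exists for all `t ≥ 0` (`forwardComplete_funkMetric`).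

For the eigenvalue, the indicatrix at `x` is the unit ball translated by `-x`. The
Busemann-Hausdorff measure is therefore Lebesgue measure and the total volume is finite. The test
function is `-1` on the ball of radius `ρ` and rises to `0` in the shell outside it. Its profile has
slope `2 / (1 - ρ)`, but it increases only outwards, where the distance is at least of order `|dx| /
(1 - ρ)`; the one-sided slope thus stays at most `2` for every `ρ` (`slopeAt_cutoff_mem`). The
energy is at most `4 vol(B ∖ ρB)`, which tends to `0`, while the mass stays above `vol(B / 2)`. The
sign of the test function matters: the argument rests on the asymmetry of the distance. -/

namespace Finsler

/-! ### Calculus of partial derivatives on the slit tangent bundle -/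

section Calculus

variable {n : ℕ} {U : Set (EuclideanSpace ℝ (Fin n))}
  {f g : EuclideanSpace ℝ (Fin n) → EuclideanSpace ℝ (Fin n) → ℝ}
  {x y : EuclideanSpace ℝ (Fin n)}

/-- Smoothness of a function of `(x, y)` on the slit tangent bundle `U × (ℝⁿ ∖ {0})`. -/
def SlitSmooth (U : Set (EuclideanSpace ℝ (Fin n)))
    (f : EuclideanSpace ℝ (Fin n) → EuclideanSpace ℝ (Fin n) → ℝ) : Prop :=
  ContDiffOn ℝ ∞ (fun q : EuclideanSpace ℝ (Fin n) × EuclideanSpace ℝ (Fin n) => f q.1 q.2)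
    (U ×ˢ {0}ᶜ)

theorem isOpen_slit (hU : IsOpen U) :
    IsOpen (U ×ˢ ({0}ᶜ : Set (EuclideanSpace ℝ (Fin n)))) :=
  hU.prod isOpen_compl_singleton

theorem SlitSmooth.contDiffAt (hf : SlitSmooth U f) (hU : IsOpen U) (hx : x ∈ U) (hy : y ≠ 0) :
    ContDiffAt ℝ ∞ (fun q : EuclideanSpace ℝ (Fin n) × EuclideanSpace ℝ (Fin n) => f q.1 q.2)
      (x, y) :=
  ContDiffOn.contDiffAt hf ((isOpen_slit hU).mem_nhds ⟨hx, hy⟩)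

theorem SlitSmooth.hasFDerivAt (hf : SlitSmooth U f) (hU : IsOpen U) (hx : x ∈ U) (hy : y ≠ 0) :
    HasFDerivAt (fun q : EuclideanSpace ℝ (Fin n) × EuclideanSpace ℝ (Fin n) => f q.1 q.2)
      (fderiv ℝ (fun q : EuclideanSpace ℝ (Fin n) × EuclideanSpace ℝ (Fin n) => f q.1 q.2) (x, y))
      (x, y) :=
  ((hf.contDiffAt hU hx hy).differentiableAt (by simp)).hasFDerivAt

theorem SlitSmooth.hasFDerivAt_left (hf : SlitSmooth U f) (hU : IsOpen U) (hx : x ∈ U)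
    (hy : y ≠ 0) :
    HasFDerivAt (fun z => f z y)
      ((fderiv ℝ (fun q : EuclideanSpace ℝ (Fin n) × EuclideanSpace ℝ (Fin n) => f q.1 q.2)
        (x, y)).comp (ContinuousLinearMap.inl ℝ _ _)) x :=
  HasFDerivAt.comp (f := fun z => (z, y)) x (hf.hasFDerivAt hU hx hy) (hasFDerivAt_prodMk_left x y)

theorem SlitSmooth.hasFDerivAt_right (hf : SlitSmooth U f) (hU : IsOpen U) (hx : x ∈ U)
    (hy : y ≠ 0) :
    HasFDerivAt (fun z => f x z)
      ((fderiv ℝ (fun q : EuclideanSpace ℝ (Fin n) × EuclideanSpace ℝ (Fin n) => f q.1 q.2)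
        (x, y)).comp (ContinuousLinearMap.inr ℝ _ _)) y :=
  HasFDerivAt.comp (f := fun z => (x, z)) y (hf.hasFDerivAt hU hx hy) (hasFDerivAt_prodMk_right x y)

theorem SlitSmooth.dX_eq (hf : SlitSmooth U f) (hU : IsOpen U) (hx : x ∈ U) (hy : y ≠ 0)
    (k : Fin n) :
    dX k f x y = fderiv ℝ (fun q : EuclideanSpace ℝ (Fin n) × EuclideanSpace ℝ (Fin n) =>
      f q.1 q.2) (x, y) (EuclideanSpace.single k 1, 0) := by
  simp [dX, (hf.hasFDerivAt_left hU hx hy).fderiv]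

theorem SlitSmooth.dY_eq (hf : SlitSmooth U f) (hU : IsOpen U) (hx : x ∈ U) (hy : y ≠ 0)
    (k : Fin n) :
    dY k f x y = fderiv ℝ (fun q : EuclideanSpace ℝ (Fin n) × EuclideanSpace ℝ (Fin n) =>
      f q.1 q.2) (x, y) (0, EuclideanSpace.single k 1) := by
  simp [dY, (hf.hasFDerivAt_right hU hx hy).fderiv]

theorem SlitSmooth.congr (hf : SlitSmooth U f) (h : ∀ x ∈ U, ∀ y ≠ 0, g x y = f x y) :
    SlitSmooth U g :=
  ContDiffOn.congr hf fun q hq => h q.1 hq.1 q.2 hq.2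

theorem SlitSmooth.fderiv_apply (hf : SlitSmooth U f) (hU : IsOpen U)
    (w : EuclideanSpace ℝ (Fin n) × EuclideanSpace ℝ (Fin n)) :
    SlitSmooth U fun x y => fderiv ℝ
      (fun q : EuclideanSpace ℝ (Fin n) × EuclideanSpace ℝ (Fin n) => f q.1 q.2) (x, y) w :=
  (ContDiffOn.fderiv_of_isOpen hf (isOpen_slit hU) (m := ∞) (by simp)).clm_apply contDiffOn_const

theorem SlitSmooth.dX (hf : SlitSmooth U f) (hU : IsOpen U) (k : Fin n) :
    SlitSmooth U (dX k f) :=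
  (hf.fderiv_apply hU _).congr fun _ hx _ hy => hf.dX_eq hU hx hy k

theorem SlitSmooth.dY (hf : SlitSmooth U f) (hU : IsOpen U) (k : Fin n) :
    SlitSmooth U (dY k f) :=
  (hf.fderiv_apply hU _).congr fun _ hx _ hy => hf.dY_eq hU hx hy k

theorem SlitSmooth.add (hf : SlitSmooth U f) (hg : SlitSmooth U g) :
    SlitSmooth U fun x y => f x y + g x y := ContDiffOn.add hf hg

theorem SlitSmooth.sub (hf : SlitSmooth U f) (hg : SlitSmooth U g) :
    SlitSmooth U fun x y => f x y - g x y := ContDiffOn.sub hf hg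

theorem SlitSmooth.mul (hf : SlitSmooth U f) (hg : SlitSmooth U g) :
    SlitSmooth U fun x y => f x y * g x y := ContDiffOn.mul hf hg

theorem slitSmooth_const (c : ℝ) : SlitSmooth U fun _ _ => c := contDiffOn_const

theorem slitSmooth_coord (i : Fin n) : SlitSmooth U fun _ y => y i := by
  have : ContDiff ℝ ∞ fun q : EuclideanSpace ℝ (Fin n) × EuclideanSpace ℝ (Fin n) => q.2 i := by
    fun_prop
  exact this.contDiffOn

theorem SlitSmooth.sum {ι : Type*} {s : Finset ι}
    {f : ι → EuclideanSpace ℝ (Fin n) → EuclideanSpace ℝ (Fin n) → ℝ}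
    (hf : ∀ i, SlitSmooth U (f i)) : SlitSmooth U fun x y => ∑ i ∈ s, f i x y :=
  ContDiffOn.sum fun i _ => hf i

theorem SlitSmooth.prod {ι : Type*} {s : Finset ι}
    {f : ι → EuclideanSpace ℝ (Fin n) → EuclideanSpace ℝ (Fin n) → ℝ}
    (hf : ∀ i, SlitSmooth U (f i)) : SlitSmooth U fun x y => ∏ i ∈ s, f i x y :=
  contDiffOn_prod fun i _ => hf i

theorem SlitSmooth.det {m : Type*} [Fintype m] [DecidableEq m]
    {A : EuclideanSpace ℝ (Fin n) → EuclideanSpace ℝ (Fin n) → Matrix m m ℝ}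
    (hA : ∀ i j, SlitSmooth U fun x y => A x y i j) : SlitSmooth U fun x y => (A x y).det := by
  simp only [Matrix.det_apply']
  exact SlitSmooth.sum fun σ => (slitSmooth_const _).mul (SlitSmooth.prod fun i => hA _ _)

theorem SlitSmooth.matrix_inv {m : Type*} [Fintype m] [DecidableEq m]
    {A : EuclideanSpace ℝ (Fin n) → EuclideanSpace ℝ (Fin n) → Matrix m m ℝ}
    (hA : ∀ i j, SlitSmooth U fun x y => A x y i j)
    (h : ∀ x ∈ U, ∀ y ≠ 0, (A x y).det ≠ 0) (i j : m) :
    SlitSmooth U fun x y => (A x y)⁻¹ i j := by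
  simp only [Matrix.inv_def, Ring.inverse_eq_inv', Matrix.smul_apply, Matrix.adjugate_apply,
    smul_eq_mul]
  refine SlitSmooth.mul (ContDiffOn.inv (SlitSmooth.det hA) fun q hq => h _ hq.1 _ hq.2)
    (SlitSmooth.det fun k l => ?_)
  simp only [Matrix.updateRow_apply]
  split_ifs
  · exact slitSmooth_const _
  · exact hA k l

/-- Both conditions cutting out the slit bundle, `x ∈ U` and `y ≠ 0`, are open, so identities valid
only there may be differentiated. This and `dY_congr` allow rewriting under derivatives. -/
theorem dX_congr (hU : IsOpen U) (h : ∀ x ∈ U, ∀ y ≠ 0, f x y = g x y) (k : Fin n) :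
    ∀ x ∈ U, ∀ y ≠ 0, dX k f x y = dX k g x y := by
  intro x hx y hy
  have : (fun z => f z y) =ᶠ[𝓝 x] fun z => g z y := by
    filter_upwards [hU.mem_nhds hx] with z hz using h z hz y hy
  simp [dX, this.fderiv_eq]

theorem dY_congr (h : ∀ x ∈ U, ∀ y ≠ 0, f x y = g x y) (k : Fin n) :
    ∀ x ∈ U, ∀ y ≠ 0, dY k f x y = dY k g x y := by
  intro x hx y hy
  have : (fun z => f x z) =ᶠ[𝓝 y] fun z => g x z := by
    filter_upwards [isOpen_compl_singleton.mem_nhds hy] with z hz using h x hx z hz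
  simp [dY, this.fderiv_eq]

section Rules

variable (hU : IsOpen U) (hx : x ∈ U) (hy : y ≠ 0)

include hU hx hy

theorem dX_mul (hf : SlitSmooth U f) (hg : SlitSmooth U g) (k : Fin n) :
    dX k (fun x y => f x y * g x y) x y = f x y * dX k g x y + dX k f x y * g x y := by
  have hf' := (hf.hasFDerivAt_left hU hx hy).differentiableAt
  have hg' := (hg.hasFDerivAt_left hU hx hy).differentiableAt
  simp only [dX, fderiv_fun_mul hf' hg', add_apply, smul_apply, smul_eq_mul]
  ring

theorem dY_mul (hf : SlitSmooth U f) (hg : SlitSmooth U g) (k : Fin n) :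
    dY k (fun x y => f x y * g x y) x y = f x y * dY k g x y + dY k f x y * g x y := by
  have hf' := (hf.hasFDerivAt_right hU hx hy).differentiableAt
  have hg' := (hg.hasFDerivAt_right hU hx hy).differentiableAt
  simp only [dY, fderiv_fun_mul hf' hg', add_apply, smul_apply, smul_eq_mul]
  ring

theorem dX_add (hf : SlitSmooth U f) (hg : SlitSmooth U g) (k : Fin n) :
    dX k (fun x y => f x y + g x y) x y = dX k f x y + dX k g x y := by
  have hf' := (hf.hasFDerivAt_left hU hx hy).differentiableAt
  have hg' := (hg.hasFDerivAt_left hU hx hy).differentiableAt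
  simp only [dX, fderiv_fun_add hf' hg', add_apply]

theorem dY_add (hf : SlitSmooth U f) (hg : SlitSmooth U g) (k : Fin n) :
    dY k (fun x y => f x y + g x y) x y = dY k f x y + dY k g x y := by
  have hf' := (hf.hasFDerivAt_right hU hx hy).differentiableAt
  have hg' := (hg.hasFDerivAt_right hU hx hy).differentiableAt
  simp only [dY, fderiv_fun_add hf' hg', add_apply]

theorem dX_sum {ι : Type*} {s : Finset ι}
    {f : ι → EuclideanSpace ℝ (Fin n) → EuclideanSpace ℝ (Fin n) → ℝ}
    (hf : ∀ i, SlitSmooth U (f i)) (k : Fin n) :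
    dX k (fun x y => ∑ i ∈ s, f i x y) x y = ∑ i ∈ s, dX k (f i) x y := by
  simp only [dX]
  rw [fderiv_fun_sum fun i _ => ((hf i).hasFDerivAt_left hU hx hy).differentiableAt]
  simp

theorem dY_sum {ι : Type*} {s : Finset ι}
    {f : ι → EuclideanSpace ℝ (Fin n) → EuclideanSpace ℝ (Fin n) → ℝ}
    (hf : ∀ i, SlitSmooth U (f i)) (k : Fin n) :
    dY k (fun x y => ∑ i ∈ s, f i x y) x y = ∑ i ∈ s, dY k (f i) x y := by
  simp only [dY]
  rw [fderiv_fun_sum fun i _ => ((hf i).hasFDerivAt_right hU hx hy).differentiableAt]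
  simp

/-- Symmetry of the second derivative on the product space. Mixed `x`, `y` commutation and pure `y`
commutation are both instances, with different direction vectors. -/
theorem fderiv_fderiv_apply_comm (hf : SlitSmooth U f)
    (v w : EuclideanSpace ℝ (Fin n) × EuclideanSpace ℝ (Fin n)) :
    fderiv ℝ (fun q : EuclideanSpace ℝ (Fin n) × EuclideanSpace ℝ (Fin n) =>
        fderiv ℝ (fun q : EuclideanSpace ℝ (Fin n) × EuclideanSpace ℝ (Fin n) => f q.1 q.2) q v)
        (x, y) w =
      fderiv ℝ (fun q : EuclideanSpace ℝ (Fin n) × EuclideanSpace ℝ (Fin n) =>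
        fderiv ℝ (fun q : EuclideanSpace ℝ (Fin n) × EuclideanSpace ℝ (Fin n) => f q.1 q.2) q w)
        (x, y) v := by
  have hc := hf.contDiffAt hU hx hy
  have h2 : (2 : WithTop ℕ∞) ≤ ((⊤ : ℕ∞) : WithTop ℕ∞) := 
    WithTop.coe_le_coe.2 (le_top : (2 : ℕ∞) ≤ ⊤)
  have hs : IsSymmSndFDerivAt ℝ (fun q : EuclideanSpace ℝ (Fin n) × EuclideanSpace ℝ (Fin n) =>
      f q.1 q.2) (x, y) := hc.isSymmSndFDerivAt (by simpa using h2)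
  have hd : DifferentiableAt ℝ (fderiv ℝ
      (fun q : EuclideanSpace ℝ (Fin n) × EuclideanSpace ℝ (Fin n) => f q.1 q.2)) (x, y) :=
    (hc.fderiv_right (m := 1) (by rw [one_add_one_eq_two]; exact h2)).differentiableAt (by simp)
  rw [fderiv_clm_apply hd (differentiableAt_const v), fderiv_clm_apply hd (differentiableAt_const w)]
  simpa using hs w v

theorem dX_dY_comm (hf : SlitSmooth U f) (k l : Fin n) :
    dX k (dY l f) x y = dY l (dX k f) x y := by
  have h1 := dX_congr hU (fun x hx y hy => hf.dY_eq hU hx hy l) k x hx y hy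
  have h2 := dY_congr (fun x hx y hy => hf.dX_eq hU hx hy k) l x hx y hy
  rw [h1, h2, (hf.fderiv_apply hU _).dX_eq hU hx hy, (hf.fderiv_apply hU _).dY_eq hU hx hy]
  exact fderiv_fderiv_apply_comm hU hx hy hf _ _

theorem dY_dY_comm (hf : SlitSmooth U f) (k l : Fin n) :
    dY k (dY l f) x y = dY l (dY k f) x y := by
  have h1 := dY_congr (fun x hx y hy => hf.dY_eq hU hx hy l) k x hx y hy
  have h2 := dY_congr (fun x hx y hy => hf.dY_eq hU hx hy k) l x hx y hy
  rw [h1, h2, (hf.fderiv_apply hU _).dY_eq hU hx hy, (hf.fderiv_apply hU _).dY_eq hU hx hy]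
  exact fderiv_fderiv_apply_comm hU hx hy hf _ _

end Rules

theorem fderiv_left_eq_sum (w : EuclideanSpace ℝ (Fin n)) :
    fderiv ℝ (fun z => f z y) x w = ∑ k, dX k f x y * w k := by
  conv_lhs => rw [← (EuclideanSpace.basisFun (Fin n) ℝ).sum_repr w, map_sum]
  simp [dX, mul_comm]

theorem fderiv_right_eq_sum (w : EuclideanSpace ℝ (Fin n)) :
    fderiv ℝ (fun z => f x z) y w = ∑ k, dY k f x y * w k := by
  conv_lhs => rw [← (EuclideanSpace.basisFun (Fin n) ℝ).sum_repr w, map_sum]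
  simp [dY, mul_comm]

theorem dX_const (c : ℝ) (k : Fin n) : dX k (fun _ _ => c) x y = 0 := by simp [dX]

theorem dY_const (c : ℝ) (k : Fin n) : dY k (fun _ _ => c) x y = 0 := by simp [dY]

theorem dX_coord (i k : Fin n) : dX k (fun _ y => y i) x y = 0 := by simp [dX]

theorem dY_coord (i k : Fin n) : dY k (fun _ y => y i) x y = if i = k then 1 else 0 := by
  have : HasFDerivAt (fun z : EuclideanSpace ℝ (Fin n) => z i)
      (EuclideanSpace.proj i : EuclideanSpace ℝ (Fin n) →L[ℝ] ℝ) y :=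
    (EuclideanSpace.proj i : EuclideanSpace ℝ (Fin n) →L[ℝ] ℝ).hasFDerivAt
  simp [dY, this.fderiv]

end Calculus

/-! ### Okada's equation: fundamental tensor, spray and nonlinear connection -/

section FunkType

variable {n : ℕ} {U : Set (EuclideanSpace ℝ (Fin n))}
  {L : EuclideanSpace ℝ (Fin n) → EuclideanSpace ℝ (Fin n) → ℝ}
  {x y : EuclideanSpace ℝ (Fin n)}

/-- Finsler functions `L` on `U ⊆ ℝⁿ` satisfying Okada's equation `L_{xᵏ} = L L_{yᵏ}`, which
characterises Funk metrics. -/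
structure IsFunkType (U : Set (EuclideanSpace ℝ (Fin n)))
    (L : EuclideanSpace ℝ (Fin n) → EuclideanSpace ℝ (Fin n) → ℝ) : Prop where
  isOpen : IsOpen U
  smooth : SlitSmooth U L
  euler : ∀ x ∈ U, ∀ y ≠ 0, ∑ k, dY k L x y * y k = L x y
  okada : ∀ x ∈ U, ∀ y ≠ 0, ∀ k, dX k L x y = L x y * dY k L x y
  posDef : ∀ x ∈ U, ∀ y ≠ 0, ∀ u ≠ 0, 0 < fundForm L x y u u

namespace IsFunkType

variable (h : IsFunkType U L) (hx : x ∈ U) (hy : y ≠ 0)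
include h

theorem smooth_dY (i : Fin n) : SlitSmooth U (dY i L) := h.smooth.dY h.isOpen i

theorem smooth_dYdY (i j : Fin n) : SlitSmooth U (dY j (dY i L)) := (h.smooth_dY i).dY h.isOpen j

include hx hy

theorem dY_dY_symm (i j : Fin n) : dY j (dY i L) x y = dY i (dY j L) x y :=
  dY_dY_comm h.isOpen hx hy h.smooth j i

theorem dY_dY_dY_rotate (i j k : Fin n) :
    dY k (dY j (dY i L)) x y = dY j (dY i (dY k L)) x y := by
  rw [dY_dY_comm h.isOpen hx hy (h.smooth_dY i)]
  exact dY_congr (fun x hx y hy => h.dY_dY_symm hx hy i k) j x hx y hy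

/-- Differentiate Euler's relation: the derivative falling on `yⁱ` reproduces `L_{yⁱ}` and cancels,
so `L_y` is homogeneous of degree `0`. One more derivative gives `sum_dY_dY_dY`, degree `-1` for
`L_{yy}`. -/
theorem sum_dY_dY (i : Fin n) : ∑ j, dY j (dY i L) x y * y j = 0 := by
  have h1 := dY_congr h.euler i x hx y hy
  rw [dY_sum h.isOpen hx hy fun k => (h.smooth_dY k).mul (slitSmooth_coord k)] at h1
  simp only [dY_mul h.isOpen hx hy (h.smooth_dY _) (slitSmooth_coord _), dY_coord, mul_ite, mul_one,
    mul_zero, Finset.sum_add_distrib, Finset.sum_ite_eq', Finset.mem_univ, if_true] at h1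
  rw [← add_eq_left.mp h1]
  exact Finset.sum_congr rfl fun j _ => by rw [h.dY_dY_symm hx hy]

theorem sum_dY_dY_dY (i j : Fin n) :
    ∑ k, dY k (dY j (dY i L)) x y * y k = - dY j (dY i L) x y := by
  have h1 := dY_congr (fun x hx y hy => h.sum_dY_dY hx hy i) j x hx y hy
  rw [dY_sum h.isOpen hx hy fun k => (h.smooth_dYdY i k).mul (slitSmooth_coord k), dY_const] at h1
  simp only [dY_mul h.isOpen hx hy (h.smooth_dYdY i _) (slitSmooth_coord _), dY_coord, mul_ite,
    mul_one, mul_zero, Finset.sum_add_distrib, Finset.sum_ite_eq', Finset.mem_univ, if_true] at h1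
  rw [neg_eq_of_add_eq_zero_right h1]
  exact Finset.sum_congr rfl fun k _ => by rw [dY_dY_comm h.isOpen hx hy (h.smooth_dY i)]

/-- The `y`-derivative of Okada's equation. With `dX_dY_dY` it eliminates every `x`-derivative in
favour of `y`-derivatives. -/
theorem dX_dY (i k : Fin n) :
    dX k (dY i L) x y = dY i L x y * dY k L x y + L x y * dY i (dY k L) x y := by
  rw [dX_dY_comm h.isOpen hx hy h.smooth,
    dY_congr (fun x hx y hy => h.okada x hx y hy k) i x hx y hy,
    dY_mul h.isOpen hx hy h.smooth (h.smooth_dY k)]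
  ring

theorem dX_dY_dY (i j k : Fin n) :
    dX k (dY j (dY i L)) x y = dY j (dY i L) x y * dY k L x y + dY i L x y * dY j (dY k L) x y
      + dY j L x y * dY i (dY k L) x y + L x y * dY j (dY i (dY k L)) x y := by
  rw [dX_dY_comm h.isOpen hx hy (h.smooth_dY i),
    dY_congr (fun x hx y hy => h.dX_dY hx hy i k) j x hx y hy,
    dY_add h.isOpen hx hy ((h.smooth_dY i).mul (h.smooth_dY k)) (h.smooth.mul (h.smooth_dYdY k i)),
    dY_mul h.isOpen hx hy (h.smooth_dY i) (h.smooth_dY k),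
    dY_mul h.isOpen hx hy h.smooth (h.smooth_dYdY k i)]
  ring

-- Stated without `IsFunkType` because it serves to prove positive definiteness of the Funk norm,
-- which is one of the fields of that structure.
omit h in
theorem fundTensor_eq_of_slitSmooth (hU : IsOpen U) (hL : SlitSmooth U L) (i j : Fin n) :
    fundTensor L i j x y = dY i L x y * dY j L x y + L x y * dY j (dY i L) x y := by
  have h1 : ∀ x ∈ U, ∀ y ≠ 0, dY i (fun x y => (1 / 2) * L x y ^ 2) x y = L x y * dY i L x y := by
    intro x hx y hy
    simp only [pow_two]
    rw [dY_mul hU hx hy (slitSmooth_const _) (hL.mul hL), dY_mul hU hx hy hL hL, dY_const]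
    ring
  rw [fundTensor, dY_congr h1 j x hx y hy, dY_mul hU hx hy hL (hL.dY hU i)]
  ring

theorem fundTensor_eq (i j : Fin n) :
    fundTensor L i j x y = dY i L x y * dY j L x y + L x y * dY j (dY i L) x y :=
  fundTensor_eq_of_slitSmooth hx hy h.isOpen h.smooth i j

theorem fundTensor_symm (i j : Fin n) : fundTensor L i j x y = fundTensor L j i x y := by
  rw [h.fundTensor_eq hx hy, h.fundTensor_eq hx hy, h.dY_dY_symm hx hy i j]
  ring

theorem sum_fundTensor_mul_self (i : Fin n) :
    ∑ j, fundTensor L i j x y * y j = L x y * dY i L x y := by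
  simp only [h.fundTensor_eq hx hy, add_mul, Finset.sum_add_distrib, mul_assoc, ← Finset.mul_sum,
    h.sum_dY_dY hx hy, h.euler x hx y hy]
  ring

omit hx hy in
theorem smooth_fundTensor (i j : Fin n) : SlitSmooth U (fundTensor L i j) :=
  (((h.smooth_dY i).mul (h.smooth_dY j)).add (h.smooth.mul (h.smooth_dYdY i j))).congr
    fun _ hx _ hy => h.fundTensor_eq hx hy i j

theorem det_fundTensor_ne_zero : (Matrix.of fun a b => fundTensor L a b x y).det ≠ 0 := by
  intro h0
  obtain ⟨v, hv, hv0⟩ := Matrix.exists_mulVec_eq_zero_iff.2 h0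
  have := h.posDef x hx y hy (WithLp.toLp 2 v) (by simpa using hv)
  refine this.ne' ?_
  have h2 : ∀ i, ∑ j, fundTensor L i j x y * v j = 0 := fun i => by
    simpa [Matrix.mulVec, dotProduct] using congrFun hv0 i
  have h3 : ∀ i, ∑ j, fundTensor L i j x y * v i * v j = 0 := fun i => by
    simp only [mul_right_comm _ (v i), ← Finset.sum_mul, h2, zero_mul]
  simp [fundForm, h3]

/-- Raising an index inverts lowering it. -/
theorem sum_fundInv_mul (z b : Fin n → ℝ) (hb : ∀ l, b l = ∑ m, fundTensor L l m x y * z m)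
    (i : Fin n) : ∑ l, fundInv L i l x y * b l = z i := by
  set A : Matrix (Fin n) (Fin n) ℝ := Matrix.of fun a b => fundTensor L a b x y with hA
  have h1 : b = A.mulVec z := by
    ext l
    simp [hb, hA, Matrix.mulVec, dotProduct]
  have h2 : A⁻¹.mulVec b = z := by
    rw [h1, Matrix.mulVec_mulVec, Matrix.nonsing_inv_mul _
      (isUnit_iff_ne_zero.2 (h.det_fundTensor_ne_zero hx hy)), Matrix.one_mulVec]
  rw [← congrFun h2 i]
  simp [fundInv, Matrix.mulVec, dotProduct, hA]

omit hx hy in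
theorem smooth_fundInv (i j : Fin n) : SlitSmooth U (fundInv L i j) :=
  SlitSmooth.matrix_inv (fun i j => h.smooth_fundTensor i j)
    (fun _ hx _ hy => h.det_fundTensor_ne_zero hx hy) i j

/-- By Okada and Euler the bracket in `sprayCoeff` equals `2 L² L_{yˡ}`, which is the vector `2 L y`
with its index lowered; raising it again gives the result. -/
theorem sprayCoeff_eq (i : Fin n) : sprayCoeff L i x y = 1 / 2 * (L x y * y i) := by
  have hX : ∀ k, ∀ x ∈ U, ∀ y ≠ 0,
      dX k (fun x y => L x y ^ 2) x y = 2 * (L x y * L x y * dY k L x y) := by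
    intro k x hx y hy
    simp only [pow_two]
    rw [dX_mul h.isOpen hx hy h.smooth h.smooth, h.okada x hx y hy]
    ring
  have hS : SlitSmooth U fun x y => L x y ^ 2 := by
    simp only [pow_two]
    exact h.smooth.mul h.smooth
  have hXY : ∀ k l, dX k (dY l (fun x y => L x y ^ 2)) x y =
      4 * L x y * dY l L x y * dY k L x y + 2 * L x y ^ 2 * dY l (dY k L) x y := by
    intro k l
    rw [dX_dY_comm h.isOpen hx hy hS, dY_congr (hX k) l x hx y hy,
      dY_mul h.isOpen hx hy (slitSmooth_const _) ((h.smooth.mul h.smooth).mul (h.smooth_dY k)),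
      dY_mul h.isOpen hx hy (h.smooth.mul h.smooth) (h.smooth_dY k),
      dY_mul h.isOpen hx hy h.smooth h.smooth, dY_const]
    ring
  rw [sprayCoeff, h.sum_fundInv_mul hx hy (fun i => 2 * L x y * y i)]
  · ring
  · intro l
    have h1 : ∑ m, fundTensor L l m x y * (2 * L x y * y m) = 2 * L x y ^ 2 * dY l L x y := by
      simp only [mul_left_comm _ (2 * L x y), ← Finset.mul_sum, h.sum_fundTensor_mul_self hx hy]
      ring
    rw [h1, hX l x hx y hy]
    simp only [hXY, add_mul, Finset.sum_add_distrib, mul_assoc, ← Finset.mul_sum,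
      h.euler x hx y hy, h.dY_dY_symm hx hy _ l, h.sum_dY_dY hx hy]
    ring

theorem nonlinConn_eq (i j : Fin n) :
    nonlinConn L i j x y = 1 / 2 * (L x y * (if i = j then 1 else 0) + dY j L x y * y i) := by
  rw [nonlinConn, dY_congr (fun x hx y hy => h.sprayCoeff_eq hx hy i) j x hx y hy,
    dY_mul h.isOpen hx hy (slitSmooth_const _) (h.smooth.mul (slitSmooth_coord i)),
    dY_mul h.isOpen hx hy h.smooth (slitSmooth_coord i), dY_coord, dY_const]
  ring

/-- Besides a multiple of the identity, `N` contains only a term proportional to `y`, so it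
contributes a radial derivative, known for each homogeneous `f`. -/
theorem horizDeriv_eq (k : Fin n)
    (f : EuclideanSpace ℝ (Fin n) → EuclideanSpace ℝ (Fin n) → ℝ) :
    horizDeriv L k f x y = dX k f x y - 1 / 2 * L x y * dY k f x y
      - 1 / 2 * dY k L x y * ∑ m, dY m f x y * y m := by
  have : ∀ m, nonlinConn L m k x y * dY m f x y =
      1 / 2 * L x y * (if m = k then dY m f x y else 0)
        + 1 / 2 * dY k L x y * (dY m f x y * y m) := by
    intro m
    rw [h.nonlinConn_eq hx hy]
    split_ifs <;> ring
  simp only [horizDeriv, this, Finset.sum_add_distrib, ← Finset.mul_sum, Finset.sum_ite_eq',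
    Finset.mem_univ, if_true]
  ring

end IsFunkType
end FunkType
-- Chern connection under Okada's equation
section FunkType

variable {n : ℕ} {U : Set (EuclideanSpace ℝ (Fin n))}
  {L : EuclideanSpace ℝ (Fin n) → EuclideanSpace ℝ (Fin n) → ℝ}
  {x y : EuclideanSpace ℝ (Fin n)}

namespace IsFunkType

variable (h : IsFunkType U L) (hx : x ∈ U) (hy : y ≠ 0)
include h hx hy

/-- The horizontal derivative of the fundamental tensor is totally symmetric. -/
theorem horizDeriv_fundTensor (i j k : Fin n) :
    horizDeriv L k (fundTensor L i j) x y =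
      2 * dY i L x y * dY j L x y * dY k L x y
        + 3 / 2 * L x y * (dY k (dY i L) x y * dY j L x y + dY i L x y * dY k (dY j L) x y
          + dY k L x y * dY j (dY i L) x y)
        + 1 / 2 * L x y ^ 2 * dY k (dY j (dY i L)) x y := by
  have hY : ∀ m, dY m (fundTensor L i j) x y =
      dY i L x y * dY m (dY j L) x y + dY m (dY i L) x y * dY j L x y
        + (L x y * dY m (dY j (dY i L)) x y + dY m L x y * dY j (dY i L) x y) := by
    intro m
    rw [dY_congr (fun x hx y hy => h.fundTensor_eq hx hy i j) m x hx y hy,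
      dY_add h.isOpen hx hy ((h.smooth_dY i).mul (h.smooth_dY j))
        (h.smooth.mul (h.smooth_dYdY i j)),
      dY_mul h.isOpen hx hy (h.smooth_dY i) (h.smooth_dY j),
      dY_mul h.isOpen hx hy h.smooth (h.smooth_dYdY i j)]
  have hX : dX k (fundTensor L i j) x y =
      dY i L x y * dX k (dY j L) x y + dX k (dY i L) x y * dY j L x y
        + (L x y * dX k (dY j (dY i L)) x y + dX k L x y * dY j (dY i L) x y) := by
    rw [dX_congr h.isOpen (fun x hx y hy => h.fundTensor_eq hx hy i j) k x hx y hy,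
      dX_add h.isOpen hx hy ((h.smooth_dY i).mul (h.smooth_dY j))
        (h.smooth.mul (h.smooth_dYdY i j)),
      dX_mul h.isOpen hx hy (h.smooth_dY i) (h.smooth_dY j),
      dX_mul h.isOpen hx hy h.smooth (h.smooth_dYdY i j)]
  -- The fundamental tensor is homogeneous of degree `0` in `y`, so the radial term of
  -- `horizDeriv_eq` vanishes.
  have hs : ∑ m, dY m (fundTensor L i j) x y * y m = 0 := by
    simp only [hY, add_mul, Finset.sum_add_distrib, mul_assoc, ← Finset.mul_sum,
      mul_comm (dY _ (dY i L) x y) (dY j L x y * _), mul_comm (dY _ L x y) (dY j (dY i L) x y * _)]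
    simp only [mul_comm (_ : ℝ) (dY _ (dY i L) x y), mul_comm (y _) (dY _ L x y),
      h.sum_dY_dY hx hy, h.sum_dY_dY_dY hx hy, h.euler x hx y hy]
    ring
  rw [h.horizDeriv_eq hx hy, hs, hX, hY k, h.dX_dY hx hy, h.dX_dY hx hy, h.dX_dY_dY hx hy,
    h.okada x hx y hy, h.dY_dY_symm hx hy k i, h.dY_dY_symm hx hy k j,
    h.dY_dY_dY_rotate hx hy i j k]
  ring

/-- Total symmetry makes the three terms of the Christoffel formula equal up to sign, and one
survives. -/
theorem chernCoeff_eq (i j k : Fin n) :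
    chernCoeff L i j k x y =
      ∑ s, fundInv L i s x y * (1 / 2 * horizDeriv L k (fundTensor L s j) x y) := by
  rw [chernCoeff, Finset.mul_sum]
  refine Finset.sum_congr rfl fun s _ => ?_
  have h1 : horizDeriv L s (fundTensor L j k) x y = horizDeriv L k (fundTensor L s j) x y := by
    rw [h.horizDeriv_fundTensor hx hy, h.horizDeriv_fundTensor hx hy,
      h.dY_dY_dY_rotate hx hy j k s, h.dY_dY_symm hx hy j s, h.dY_dY_symm hx hy k s]
    ring
  have h2 : horizDeriv L j (fundTensor L k s) x y = horizDeriv L k (fundTensor L s j) x y := by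
    rw [h.horizDeriv_fundTensor hx hy, h.horizDeriv_fundTensor hx hy,
      h.dY_dY_dY_rotate hx hy s j k, h.dY_dY_symm hx hy k j, h.dY_dY_symm hx hy k s]
    ring
  rw [h1, h2]
  ring

/-- After lowering `i`, homogeneity turns both sides into the same expression in `L`, `L_y` and
`L_{yy}`; invertibility of the fundamental tensor then removes the lowering. -/
theorem sum_chernCoeff_mul (i k : Fin n) :
    ∑ j, chernCoeff L i j k x y * y j = nonlinConn L i k x y := by
  have h1 : ∀ s, ∑ j, 1 / 2 * horizDeriv L k (fundTensor L s j) x y * y j =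
      ∑ m, fundTensor L s m x y * nonlinConn L m k x y := by
    intro s
    have h2 : ∀ m, fundTensor L s m x y * nonlinConn L m k x y =
        1 / 2 * L x y * (if m = k then fundTensor L s m x y else 0)
          + 1 / 2 * dY k L x y * (fundTensor L s m x y * y m) := by
      intro m
      rw [h.nonlinConn_eq hx hy]
      split_ifs <;> ring
    have h3 : ∀ j, 1 / 2 * horizDeriv L k (fundTensor L s j) x y * y j =
        (dY s L x y * dY k L x y + 3 / 4 * L x y * dY k (dY s L) x y) * (dY j L x y * y j)
          + 3 / 4 * L x y * dY s L x y * (dY j (dY k L) x y * y j)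
          + 3 / 4 * L x y * dY k L x y * (dY j (dY s L) x y * y j)
          + 1 / 4 * L x y ^ 2 * (dY j (dY s (dY k L)) x y * y j) := by
      intro j
      rw [h.horizDeriv_fundTensor hx hy, h.dY_dY_dY_rotate hx hy s j k, h.dY_dY_symm hx hy j k]
      ring
    simp only [h2, h3, Finset.sum_add_distrib, ← Finset.mul_sum, Finset.sum_ite_eq',
      Finset.mem_univ, if_true, h.sum_fundTensor_mul_self hx hy, h.fundTensor_eq hx hy s k,
      h.sum_dY_dY hx hy, h.sum_dY_dY_dY hx hy, h.euler x hx y hy, h.dY_dY_symm hx hy k s]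
    ring
  rw [← h.sum_fundInv_mul hx hy (fun m => nonlinConn L m k x y) _ h1 i]
  simp only [h.chernCoeff_eq hx hy, Finset.sum_mul, Finset.mul_sum, mul_assoc]
  exact Finset.sum_comm

end IsFunkType
end FunkType
theorem fundForm_sub_smul {n : ℕ} (L : EuclideanSpace ℝ (Fin n) → EuclideanSpace ℝ (Fin n) → ℝ)
    (x y u v : EuclideanSpace ℝ (Fin n)) (c : ℝ) :
    fundForm L x y (u - c • v) (u - c • v) =
      fundForm L x y u u - c * fundForm L x y u v - c * fundForm L x y v u
        + c ^ 2 * fundForm L x y v v := by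
  simp only [fundForm, Finset.mul_sum, ← Finset.sum_sub_distrib, ← Finset.sum_add_distrib]
  refine Finset.sum_congr rfl fun i _ => Finset.sum_congr rfl fun j _ => ?_
  simp
  ring

/-! ### Curvature under Okada's equation -/

section FunkType

variable {n : ℕ} {U : Set (EuclideanSpace ℝ (Fin n))}
  {L f g : EuclideanSpace ℝ (Fin n) → EuclideanSpace ℝ (Fin n) → ℝ}
  {x y : EuclideanSpace ℝ (Fin n)}

theorem horizDeriv_congr (hU : IsOpen U) (hfg : ∀ x ∈ U, ∀ y ≠ 0, f x y = g x y) (k : Fin n) :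
    ∀ x ∈ U, ∀ y ≠ 0, horizDeriv L k f x y = horizDeriv L k g x y := by
  intro x hx y hy
  simp only [horizDeriv, dX_congr hU hfg k x hx y hy, dY_congr hfg _ x hx y hy]

theorem horizDeriv_mul (hU : IsOpen U) (hx : x ∈ U) (hy : y ≠ 0) (hf : SlitSmooth U f)
    (hg : SlitSmooth U g) (k : Fin n) :
    horizDeriv L k (fun x y => f x y * g x y) x y =
      f x y * horizDeriv L k g x y + horizDeriv L k f x y * g x y := by
  simp only [horizDeriv, dX_mul hU hx hy hf hg, dY_mul hU hx hy hf hg, mul_add, mul_sub, sub_mul,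
    Finset.sum_add_distrib, Finset.mul_sum, Finset.sum_mul]
  rw [Finset.sum_congr rfl fun m _ => mul_left_comm (nonlinConn L m k x y) (f x y) _]
  simp only [mul_assoc]
  ring

theorem horizDeriv_sum (hU : IsOpen U) (hx : x ∈ U) (hy : y ≠ 0) {ι : Type*} {s : Finset ι}
    {f : ι → EuclideanSpace ℝ (Fin n) → EuclideanSpace ℝ (Fin n) → ℝ}
    (hf : ∀ i, SlitSmooth U (f i)) (k : Fin n) :
    horizDeriv L k (fun x y => ∑ i ∈ s, f i x y) x y = ∑ i ∈ s, horizDeriv L k (f i) x y := by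
  simp only [horizDeriv, dX_sum hU hx hy hf, dY_sum hU hx hy hf, Finset.sum_sub_distrib,
    Finset.mul_sum]
  rw [Finset.sum_comm]

theorem horizDeriv_coord (i k : Fin n) :
    horizDeriv L k (fun _ y => y i) x y = - nonlinConn L i k x y := by
  simp [horizDeriv, dX_coord, dY_coord]

namespace IsFunkType

variable (h : IsFunkType U L)
include h

theorem smooth_nonlinConn (i j : Fin n) : SlitSmooth U (nonlinConn L i j) :=
  ((slitSmooth_const _).mul ((h.smooth.mul (slitSmooth_const _)).add
    ((h.smooth_dY j).mul (slitSmooth_coord i)))).congr fun _ hx _ hy => h.nonlinConn_eq hx hy i j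

theorem smooth_horizDeriv (hf : SlitSmooth U f) (k : Fin n) : SlitSmooth U (horizDeriv L k f) :=
  (hf.dX h.isOpen k).sub
    (SlitSmooth.sum fun m => (h.smooth_nonlinConn m k).mul (hf.dY h.isOpen m))

theorem smooth_chernCoeff (i j k : Fin n) : SlitSmooth U (chernCoeff L i j k) :=
  (SlitSmooth.sum fun s => (h.smooth_fundInv i s).mul ((slitSmooth_const (1 / 2)).mul
    (h.smooth_horizDeriv (h.smooth_fundTensor s j) k))).congr
    fun _ hx _ hy => h.chernCoeff_eq hx hy i j k

variable (hx : x ∈ U) (hy : y ≠ 0)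
include hx hy

/-- Contracting `N` once more with `y`, by Euler's relation. This is the acceleration term of the
geodesic equation. -/
theorem sum_chernCoeff_mul_mul (i : Fin n) :
    ∑ j, ∑ k, chernCoeff L i j k x y * y j * y k = L x y * y i := by
  rw [Finset.sum_comm]
  simp only [← Finset.sum_mul, h.sum_chernCoeff_mul hx hy]
  have h1 : ∀ k, nonlinConn L i k x y * y k =
      1 / 2 * L x y * (if i = k then y k else 0) + 1 / 2 * y i * (dY k L x y * y k) := by
    intro k
    rw [h.nonlinConn_eq hx hy]
    split_ifs <;> ring
  simp only [h1, Finset.sum_add_distrib, ← Finset.mul_sum, Finset.sum_ite_eq, Finset.mem_univ,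
    if_true, h.euler x hx y hy]
  ring

theorem horizDeriv_self (k : Fin n) : horizDeriv L k L x y = 0 := by
  rw [h.horizDeriv_eq hx hy, h.euler x hx y hy, h.okada x hx y hy]
  ring

theorem horizDeriv_dY (k l : Fin n) :
    horizDeriv L k (dY l L) x y = dY l L x y * dY k L x y + 1 / 2 * L x y * dY l (dY k L) x y := by
  rw [h.horizDeriv_eq hx hy, h.sum_dY_dY hx hy, h.dX_dY hx hy, h.dY_dY_symm hx hy k l]
  ring

theorem horizDeriv_nonlinConn (i k l : Fin n) :
    horizDeriv L k (nonlinConn L i l) x y =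
      1 / 2 * ((dY l L x y * dY k L x y + 1 / 2 * L x y * dY l (dY k L) x y) * y i
        - dY l L x y * nonlinConn L i k x y) := by
  have hc : ∀ c : ℝ, horizDeriv L k (fun _ _ => c) x y = 0 := fun c => by
    simp [horizDeriv, dX_const, dY_const]
  have ha : ∀ {f g}, SlitSmooth U f → SlitSmooth U g → horizDeriv L k (fun x y => f x y + g x y) x y
      = horizDeriv L k f x y + horizDeriv L k g x y := by
    intro f g hf hg
    simp only [horizDeriv, dX_add h.isOpen hx hy hf hg, dY_add h.isOpen hx hy hf hg, mul_add,
      Finset.sum_add_distrib]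
    ring
  rw [horizDeriv_congr h.isOpen (fun x hx y hy => h.nonlinConn_eq hx hy i l) k x hx y hy,
    horizDeriv_mul h.isOpen hx hy (slitSmooth_const _) ((h.smooth.mul (slitSmooth_const _)).add
      ((h.smooth_dY l).mul (slitSmooth_coord i))), hc,
    ha (h.smooth.mul (slitSmooth_const _)) ((h.smooth_dY l).mul (slitSmooth_coord i)),
    horizDeriv_mul h.isOpen hx hy h.smooth (slitSmooth_const _), hc, h.horizDeriv_self hx hy,
    horizDeriv_mul h.isOpen hx hy (h.smooth_dY l) (slitSmooth_coord i), horizDeriv_coord,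
    h.horizDeriv_dY hx hy]
  ring

/-- Contracting the Chern curvature with the reference vector gives the curvature of the nonlinear
connection. -/
theorem sum_mul_chernCurv (i k l : Fin n) :
    ∑ j, y j * chernCurv L j i k l x y =
      horizDeriv L k (nonlinConn L i l) x y - horizDeriv L l (nonlinConn L i k) x y := by
  -- Since `δyʲ/δxᵏ = -Nʲ_k`, moving `yʲ` inside the derivative creates a `Γ N` term. These terms
  -- cancel against the quadratic `Γ Γ` part computed in `h2`.
  have h1 : ∀ k l, ∑ j, y j * horizDeriv L k (chernCoeff L i j l) x y =
      horizDeriv L k (nonlinConn L i l) x y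
        + ∑ j, chernCoeff L i j l x y * nonlinConn L j k x y := by
    intro k l
    rw [← horizDeriv_congr h.isOpen (fun x hx y hy => h.sum_chernCoeff_mul hx hy i l) k x hx y hy,
      horizDeriv_sum h.isOpen hx hy fun j => (h.smooth_chernCoeff i j l).mul (slitSmooth_coord j),
      ← Finset.sum_add_distrib]
    refine Finset.sum_congr rfl fun j _ => ?_
    rw [horizDeriv_mul h.isOpen hx hy (h.smooth_chernCoeff i j l) (slitSmooth_coord j),
      horizDeriv_coord]
    ring
  have h2 : ∀ k l, ∑ j, y j * ∑ m, chernCoeff L i m k x y * chernCoeff L m j l x y =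
      ∑ m, chernCoeff L i m k x y * nonlinConn L m l x y := by
    intro k l
    simp only [← h.sum_chernCoeff_mul hx hy _ l, Finset.mul_sum]
    rw [Finset.sum_comm]
    refine Finset.sum_congr rfl fun m _ => Finset.sum_congr rfl fun j _ => ?_
    ring
  simp only [chernCurv, mul_add, mul_sub, Finset.sum_add_distrib, Finset.sum_sub_distrib, h1, h2]
  ring

/-- Antisymmetrising `δNⁱ_l/δxᵏ` in `k`, `l` kills the symmetric terms in `L_{yᵏ} L_{yˡ}` and
`L_{yᵏyˡ}`. What remains is linear in `L_y` and the identity. -/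
theorem curvVec_apply (u : EuclideanSpace ℝ (Fin n)) (i : Fin n) :
    curvVec L x y u i = 1 / 4 * L x y * ((∑ k, dY k L x y * u k) * y i - L x y * u i) := by
  have h1 : ∀ k l, horizDeriv L k (nonlinConn L i l) x y - horizDeriv L l (nonlinConn L i k) x y =
      1 / 4 * L x y * (dY k L x y * (if i = l then 1 else 0)
        - dY l L x y * (if i = k then 1 else 0)) := by
    intro k l
    rw [h.horizDeriv_nonlinConn hx hy, h.horizDeriv_nonlinConn hx hy, h.nonlinConn_eq hx hy,
      h.nonlinConn_eq hx hy, h.dY_dY_symm hx hy k l]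
    ring
  have h2 : curvVec L x y u i = ∑ k, ∑ l, (∑ j, y j * chernCurv L j i k l x y) * u k * y l := by
    simp only [curvVec, Finset.sum_mul]
    rw [Finset.sum_comm]
    exact Finset.sum_congr rfl fun k _ => Finset.sum_comm
  have h3 : ∀ k l, (∑ j, y j * chernCurv L j i k l x y) * u k * y l =
      1 / 4 * L x y * ((dY k L x y * u k) * (if i = l then y l else 0))
        - 1 / 4 * L x y * ((if i = k then u k else 0) * (dY l L x y * y l)) := by
    intro k l
    rw [h.sum_mul_chernCurv hx hy, h1]
    split_ifs <;> ring
  simp only [h2, h3, Finset.sum_sub_distrib, ← Finset.mul_sum, Finset.sum_ite_eq, Finset.mem_univ,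
    if_true, h.euler x hx y hy, ← Finset.sum_mul]
  ring

theorem fundForm_self_left (w : EuclideanSpace ℝ (Fin n)) :
    fundForm L x y y w = L x y * ∑ k, dY k L x y * w k := by
  rw [fundForm, Finset.sum_comm, Finset.mul_sum]
  refine Finset.sum_congr rfl fun j _ => ?_
  rw [← Finset.sum_mul, ← mul_assoc, ← h.sum_fundTensor_mul_self hx hy]
  simp only [h.fundTensor_symm hx hy j]

theorem fundForm_symm (u w : EuclideanSpace ℝ (Fin n)) :
    fundForm L x y u w = fundForm L x y w u := by
  rw [fundForm, Finset.sum_comm, fundForm]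
  refine Finset.sum_congr rfl fun i _ => Finset.sum_congr rfl fun j _ => ?_
  rw [h.fundTensor_symm hx hy]
  ring

theorem localFlagCurv_eq {u : EuclideanSpace ℝ (Fin n)} (hu : LinearIndependent ℝ ![y, u]) :
    localFlagCurv L x y u = -1 / 4 := by
  have hvv : fundForm L x y y y = L x y ^ 2 := by
    rw [h.fundForm_self_left hx hy, h.euler x hx y hy, pow_two]
  have hL : L x y ≠ 0 := fun h0 => (h.posDef x hx y hy y hy).ne' (by rw [hvv, h0]; ring)
  set a := ∑ k, dY k L x y * u k with ha
  have hvu : fundForm L x y y u = L x y * a := h.fundForm_self_left hx hy u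
  have huv : fundForm L x y u y = L x y * a := by rw [h.fundForm_symm hx hy, hvu]
  have hpos : 0 < fundForm L x y u u - a ^ 2 := by
    -- Strict Cauchy-Schwarz: `a / L = g(y, u) / g(y, y)`, so this vector is the component of `u`
    -- orthogonal to `y`.
    have hne : u - (a / L x y) • y ≠ 0 := by
      intro h0
      have := (LinearIndependent.pair_iff.1 hu) (-(a / L x y)) 1 (by rw [← h0]; module)
      exact one_ne_zero this.2
    have := h.posDef x hx y hy _ hne
    rw [fundForm_sub_smul, hvv, hvu, huv] at this
    convert this using 1
    field_simp
    ring
  have hc : curvVec L x y u = (1 / 4 * L x y * a) • y - (1 / 4 * L x y ^ 2) • u := by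
    ext i
    rw [h.curvVec_apply hx hy]
    simp
    ring
  have hnum : fundForm L x y (curvVec L x y u) u =
      1 / 4 * L x y * a * (L x y * a) - 1 / 4 * L x y ^ 2 * fundForm L x y u u := by
    rw [hc, ← hvu]
    simp only [fundForm, Finset.mul_sum, ← Finset.sum_sub_distrib]
    refine Finset.sum_congr rfl fun i _ => Finset.sum_congr rfl fun j _ => ?_
    simp
    ring
  rw [localFlagCurv, hnum, hvv, huv, div_eq_iff]
  · ring
  · have : L x y ^ 2 * (fundForm L x y u u - a ^ 2) ≠ 0 := by positivity
    convert this using 1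
    ring

end IsFunkType
end FunkType
-- Invariance under changes of `L` off the slit bundle
section FunkType

variable {n : ℕ} {U : Set (EuclideanSpace ℝ (Fin n))}
  {L L' : EuclideanSpace ℝ (Fin n) → EuclideanSpace ℝ (Fin n) → ℝ}

theorem fundForm_congr (hLL : ∀ x ∈ U, ∀ y ≠ 0, L' x y = L x y) {x y : EuclideanSpace ℝ (Fin n)}
    (hx : x ∈ U) (hy : y ≠ 0) (u w : EuclideanSpace ℝ (Fin n)) :
    fundForm L' x y u w = fundForm L x y u w := by
  have h1 : ∀ x ∈ U, ∀ y ≠ 0, (1 / 2) * L' x y ^ 2 = (1 / 2) * L x y ^ 2 := fun x hx y hy => by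
    rw [hLL x hx y hy]
  have h2 : ∀ i j, fundTensor L' i j x y = fundTensor L i j x y := fun i j =>
    dY_congr (dY_congr h1 i) j x hx y hy
  simp only [fundForm, h2]

theorem IsFunkType.congr (h : IsFunkType U L) (hLL : ∀ x ∈ U, ∀ y ≠ 0, L' x y = L x y) :
    IsFunkType U L' where
  isOpen := h.isOpen
  smooth := h.smooth.congr hLL
  euler x hx y hy := by
    simp only [dY_congr hLL _ x hx y hy, hLL x hx y hy, h.euler x hx y hy]
  okada x hx y hy k := by
    rw [dX_congr h.isOpen hLL k x hx y hy, dY_congr hLL k x hx y hy, hLL x hx y hy,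
      h.okada x hx y hy]
  posDef x hx y hy u hu := by
    rw [fundForm_congr hLL hx hy]
    exact h.posDef x hx y hy u hu

end FunkType

/-! ### The Funk norm on the ball -/

section FunkNorm

variable {n : ℕ} {x y : EuclideanSpace ℝ (Fin n)}

theorem one_sub_norm_sq_pos (hx : ‖x‖ < 1) : 0 < 1 - ‖x‖ ^ 2 := by
  nlinarith [norm_nonneg x]

theorem funk_radicand_nonneg (hx : ‖x‖ < 1) (y : EuclideanSpace ℝ (Fin n)) :
    0 ≤ ‖y‖ ^ 2 - (‖x‖ ^ 2 * ‖y‖ ^ 2 - inner ℝ x y ^ 2) := by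
  nlinarith [mul_nonneg (one_sub_norm_sq_pos hx).le (sq_nonneg ‖y‖), sq_nonneg (inner ℝ x y : ℝ)]

theorem funk_radicand_pos (hx : ‖x‖ < 1) (hy : y ≠ 0) :
    0 < ‖y‖ ^ 2 - (‖x‖ ^ 2 * ‖y‖ ^ 2 - inner ℝ x y ^ 2) := by
  have : 0 < ‖y‖ ^ 2 := by positivity
  nlinarith [mul_pos (one_sub_norm_sq_pos hx) this, sq_nonneg (inner ℝ x y : ℝ)]

theorem mul_funkNorm_sub_inner (hx : ‖x‖ < 1) (y : EuclideanSpace ℝ (Fin n)) :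
    (1 - ‖x‖ ^ 2) * funkNorm x y - inner ℝ x y =
      √(‖y‖ ^ 2 - (‖x‖ ^ 2 * ‖y‖ ^ 2 - inner ℝ x y ^ 2)) := by
  have := (one_sub_norm_sq_pos hx).ne'
  rw [funkNorm]
  field_simp
  ring

/-- Half the derivative in `F` of the quadratic `funkNorm_quadratic`. Its positivity allows the
implicitly differentiated equations to be solved. -/
theorem mul_funkNorm_sub_inner_pos (hx : ‖x‖ < 1) (hy : y ≠ 0) :
    0 < (1 - ‖x‖ ^ 2) * funkNorm x y - inner ℝ x y := by
  rw [mul_funkNorm_sub_inner hx]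
  exact Real.sqrt_pos.2 (funk_radicand_pos hx hy)

theorem funkNorm_quadratic (hx : ‖x‖ < 1) (y : EuclideanSpace ℝ (Fin n)) :
    (1 - ‖x‖ ^ 2) * funkNorm x y ^ 2 - 2 * inner ℝ x y * funkNorm x y - ‖y‖ ^ 2 = 0 := by
  have h1 := Real.sq_sqrt (funk_radicand_nonneg hx y)
  rw [← mul_funkNorm_sub_inner hx] at h1
  have ha := (one_sub_norm_sq_pos hx).ne'
  apply mul_left_cancel₀ ha
  linear_combination h1

theorem funkNorm_nonneg (hx : ‖x‖ < 1) (y : EuclideanSpace ℝ (Fin n)) : 0 ≤ funkNorm x y := by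
  have ha := one_sub_norm_sq_pos hx
  rw [funkNorm, ← add_div]
  refine div_nonneg ?_ ha.le
  have : |(inner ℝ x y : ℝ)| ≤ √(‖y‖ ^ 2 - (‖x‖ ^ 2 * ‖y‖ ^ 2 - inner ℝ x y ^ 2)) := by
    apply Real.abs_le_sqrt
    nlinarith [mul_nonneg ha.le (sq_nonneg ‖y‖)]
  linarith [neg_abs_le (inner ℝ x y : ℝ)]

theorem funkNorm_pos (hx : ‖x‖ < 1) (hy : y ≠ 0) : 0 < funkNorm x y := by
  refine (funkNorm_nonneg hx y).lt_of_ne fun h0 => ?_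
  have := funkNorm_quadratic hx y
  rw [← h0] at this
  have h2 : 0 < ‖y‖ ^ 2 := by positivity
  linarith

theorem norm_smul_add_sq (x y : EuclideanSpace ℝ (Fin n)) (t : ℝ) :
    ‖t • x + y‖ ^ 2 = t ^ 2 * ‖x‖ ^ 2 + 2 * t * inner ℝ x y + ‖y‖ ^ 2 := by
  rw [norm_add_sq_real, norm_smul, inner_smul_left, mul_pow, Real.norm_eq_abs, sq_abs]
  simp
  ring

/-- `x + y / F(x, y)` lies on the unit sphere. -/
theorem norm_funkNorm_smul_add (hx : ‖x‖ < 1) (y : EuclideanSpace ℝ (Fin n)) :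
    ‖funkNorm x y • x + y‖ = funkNorm x y := by
  rw [← sq_eq_sq₀ (norm_nonneg _) (funkNorm_nonneg hx y), norm_smul_add_sq]
  linear_combination - funkNorm_quadratic hx y

/-- Squaring gives the quadratic satisfied by `F`; nonnegativity of `t` selects the root with the
plus sign. -/
theorem eq_funkNorm (hx : ‖x‖ < 1) {t : ℝ} (ht : 0 ≤ t) (h : ‖t • x + y‖ = t) :
    t = funkNorm x y := by
  have ha := one_sub_norm_sq_pos hx
  have h1 : t ^ 2 * ‖x‖ ^ 2 + 2 * t * inner ℝ x y + ‖y‖ ^ 2 = t ^ 2 := by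
    rw [← norm_smul_add_sq, h]
  -- By `h1`, `2t` times this quantity is `(1 - ‖x‖²) t² + ‖y‖²`.
  have h2 : 0 ≤ (1 - ‖x‖ ^ 2) * t - inner ℝ x y := by
    rcases ht.eq_or_lt with rfl | ht'
    · have : y = 0 := by simpa using h
      simp [this]
    · have : 0 ≤ (2 * t) * ((1 - ‖x‖ ^ 2) * t - inner ℝ x y) := by
        nlinarith [mul_nonneg ha.le (sq_nonneg t), sq_nonneg ‖y‖]
      exact nonneg_of_mul_nonneg_right this (by positivity)
  have h3 : (1 - ‖x‖ ^ 2) * t - inner ℝ x y =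
      √(‖y‖ ^ 2 - (‖x‖ ^ 2 * ‖y‖ ^ 2 - inner ℝ x y ^ 2)) := by
    symm
    rw [Real.sqrt_eq_iff_mul_self_eq (funk_radicand_nonneg hx y) h2]
    linear_combination (1 - ‖x‖ ^ 2) * h1
  rw [← mul_funkNorm_sub_inner hx] at h3
  exact mul_left_cancel₀ ha.ne' (by linarith)

theorem funkNorm_smul (hx : ‖x‖ < 1) {t : ℝ} (ht : 0 ≤ t) (y : EuclideanSpace ℝ (Fin n)) :
    funkNorm x (t • y) = t * funkNorm x y := by
  symm
  refine eq_funkNorm hx (mul_nonneg ht (funkNorm_nonneg hx y)) ?_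
  rw [mul_smul, ← smul_add, norm_smul, norm_funkNorm_smul_add hx, Real.norm_of_nonneg ht]

/-- The unit ball of the Funk norm at `x` is the Euclidean unit ball centred at `-x`. -/
theorem funkNorm_lt_one_iff (hx : ‖x‖ < 1) : funkNorm x y < 1 ↔ ‖x + y‖ < 1 := by
  have ha := one_sub_norm_sq_pos hx
  have h1 : ‖x + y‖ ^ 2 = ‖x‖ ^ 2 + 2 * inner ℝ x y + ‖y‖ ^ 2 := norm_add_sq_real x y
  have h2 : funkNorm x y < 1 ↔ √(‖y‖ ^ 2 - (‖x‖ ^ 2 * ‖y‖ ^ 2 - inner ℝ x y ^ 2)) <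
      1 - ‖x‖ ^ 2 - inner ℝ x y := by
    rw [funkNorm, ← add_div, div_lt_one ha]
    constructor <;> intro h <;> linarith
  have h3 : ‖x + y‖ < 1 ↔ ‖x + y‖ ^ 2 < 1 := by
    rw [sq_lt_one_iff_abs_lt_one, abs_norm]
  rw [h2, h3, h1]
  constructor
  · intro h
    have h4 := (Real.sqrt_lt' ((Real.sqrt_nonneg _).trans_lt h)).1 h
    have h5 : 0 < (1 - ‖x‖ ^ 2) * (1 - ‖x‖ ^ 2 - 2 * inner ℝ x y - ‖y‖ ^ 2) := by
      linear_combination h4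
    linarith [(mul_pos_iff_of_pos_left ha).1 h5]
  · intro h
    have h4 : 0 < 1 - ‖x‖ ^ 2 - inner ℝ x y := by nlinarith [sq_nonneg ‖y‖]
    rw [Real.sqrt_lt' h4]
    have h5 : 0 < (1 - ‖x‖ ^ 2) * (1 - ‖x‖ ^ 2 - 2 * inner ℝ x y - ‖y‖ ^ 2) :=
      mul_pos ha (by linarith)
    linear_combination h5

/-- The unit ball is on one side of its supporting hyperplanes. -/
theorem inner_le_funkNorm_mul (hx : ‖x‖ < 1) (y : EuclideanSpace ℝ (Fin n))
    {w : EuclideanSpace ℝ (Fin n)} (hw : ‖w‖ ≤ 1) :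
    inner ℝ w y ≤ funkNorm x y * (1 - inner ℝ w x) := by
  have h1 := real_inner_le_norm w (funkNorm x y • x + y)
  rw [norm_funkNorm_smul_add hx, inner_add_right, inner_smul_right] at h1
  nlinarith [mul_le_mul_of_nonneg_right hw (funkNorm_nonneg hx y)]

theorem continuousOn_funkNorm :
    ContinuousOn (fun q : EuclideanSpace ℝ (Fin n) × EuclideanSpace ℝ (Fin n) => funkNorm q.1 q.2)
      (Metric.ball 0 1 ×ˢ Set.univ) := by
  unfold funkNorm
  have h : ∀ q ∈ (Metric.ball (0 : EuclideanSpace ℝ (Fin n)) 1 ×ˢ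
      (Set.univ : Set (EuclideanSpace ℝ (Fin n)))), 1 - ‖q.1‖ ^ 2 ≠ 0 := fun q hq =>
    (one_sub_norm_sq_pos (by simpa using hq.1)).ne'
  refine ContinuousOn.add (ContinuousOn.div (by fun_prop) (by fun_prop) h)
    (ContinuousOn.div (by fun_prop) (by fun_prop) h)

theorem slitSmooth_funkNorm :
    SlitSmooth (Metric.ball 0 1) (funkNorm : EuclideanSpace ℝ (Fin n) → _ → ℝ) := by
  unfold funkNorm SlitSmooth
  have h : ∀ q ∈ (Metric.ball (0 : EuclideanSpace ℝ (Fin n)) 1 ×ˢ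
      ({0}ᶜ : Set (EuclideanSpace ℝ (Fin n)))), 1 - ‖q.1‖ ^ 2 ≠ 0 := fun q hq =>
    (one_sub_norm_sq_pos (by simpa using hq.1)).ne'
  have h1 : ContDiff ℝ ∞ fun q : EuclideanSpace ℝ (Fin n) × EuclideanSpace ℝ (Fin n) =>
      ‖q.1‖ ^ 2 := contDiff_fst.norm_sq ℝ
  have h2 : ContDiff ℝ ∞ fun q : EuclideanSpace ℝ (Fin n) × EuclideanSpace ℝ (Fin n) =>
      ‖q.2‖ ^ 2 := contDiff_snd.norm_sq ℝ
  have h3 : ContDiff ℝ ∞ fun q : EuclideanSpace ℝ (Fin n) × EuclideanSpace ℝ (Fin n) =>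
      (inner ℝ q.1 q.2 : ℝ) := contDiff_fst.inner ℝ contDiff_snd
  refine ContDiffOn.add (ContDiffOn.div (ContDiffOn.sqrt ?_ ?_) ?_ h)
    (ContDiffOn.div h3.contDiffOn ?_ h)
  · exact (h2.sub ((h1.mul h2).sub (h3.pow 2))).contDiffOn
  · intro q hq
    exact (funk_radicand_pos (by simpa using hq.1) hq.2).ne'
  · exact (contDiff_const.sub h1).contDiffOn
  · exact (contDiff_const.sub h1).contDiffOn

/-- Implicit differentiation of `funkNorm_quadratic` in `y`. -/
theorem fderiv_funkNorm_right (hx : ‖x‖ < 1) (hy : y ≠ 0) (w : EuclideanSpace ℝ (Fin n)) :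
    fderiv ℝ (fun z => funkNorm x z) y w * ((1 - ‖x‖ ^ 2) * funkNorm x y - inner ℝ x y) =
      funkNorm x y * inner ℝ x w + inner ℝ y w := by
  have hF := (slitSmooth_funkNorm.hasFDerivAt_right Metric.isOpen_ball (mem_ball_zero_iff.2 hx)
    hy).differentiableAt.hasFDerivAt
  have h1 := ((((hF.pow 2).const_mul (1 - ‖x‖ ^ 2)).sub
    (((hasFDerivAt_const x y).inner ℝ (hasFDerivAt_id y)).const_mul 2 |>.mul hF)).sub
      (hasStrictFDerivAt_norm_sq y).hasFDerivAt)
  have h2 : (fun z => (1 - ‖x‖ ^ 2) * funkNorm x z ^ 2 - 2 * inner ℝ x z * funkNorm x z - ‖z‖ ^ 2)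
      = fun _ => 0 := funext fun z => funkNorm_quadratic hx z
  have h3 := h1.unique (h2 ▸ hasFDerivAt_const (0 : ℝ) y)
  have h4 := DFunLike.congr_fun h3 w
  simp at h4
  linear_combination h4 / 2

/-- The same in `x`. The right-hand side is `F` times that of `fderiv_funkNorm_right`, which is
Okada's equation. -/
theorem fderiv_funkNorm_left (hx : ‖x‖ < 1) (hy : y ≠ 0) (w : EuclideanSpace ℝ (Fin n)) :
    fderiv ℝ (fun z => funkNorm z y) x w * ((1 - ‖x‖ ^ 2) * funkNorm x y - inner ℝ x y) =
      funkNorm x y * (funkNorm x y * inner ℝ x w + inner ℝ y w) := by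
  have hF := (slitSmooth_funkNorm.hasFDerivAt_left Metric.isOpen_ball (mem_ball_zero_iff.2 hx)
    hy).differentiableAt.hasFDerivAt
  have h1 := (((((hasFDerivAt_const (1 : ℝ) x).sub
    (hasStrictFDerivAt_norm_sq x).hasFDerivAt).mul (hF.pow 2)).sub
    (((hasFDerivAt_id x).inner ℝ (hasFDerivAt_const y x)).const_mul 2 |>.mul hF)).sub
      (hasFDerivAt_const (‖y‖ ^ 2) x))
  have h2 : (fun z => (1 - ‖z‖ ^ 2) * funkNorm z y ^ 2 - 2 * inner ℝ z y * funkNorm z y - ‖y‖ ^ 2)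
      =ᶠ[𝓝 x] fun _ => 0 := by
    filter_upwards [Metric.isOpen_ball.mem_nhds (mem_ball_zero_iff.2 hx)] with z hz
    exact funkNorm_quadratic (mem_ball_zero_iff.1 hz) y
  have h3 := h1.unique ((hasFDerivAt_const (0 : ℝ) x).congr_of_eventuallyEq h2)
  have h4 := DFunLike.congr_fun h3 w
  simp at h4
  rw [real_inner_comm y w] at h4
  linear_combination h4 / 2

/-- With `d = F_y(u)` and `c = F_{yy}(u, u)` the form is `d² + F c`. A second implicit
differentiation expresses `c`, and Cauchy-Schwarz against `z = F x + y`, of norm `F`, gives `c ≥ 0`.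
-/
theorem fundForm_funkNorm_pos (hx : ‖x‖ < 1) (hy : y ≠ 0) {u : EuclideanSpace ℝ (Fin n)}
    (hu : u ≠ 0) : 0 < fundForm funkNorm x y u u := by
  have hU : IsOpen (Metric.ball (0 : EuclideanSpace ℝ (Fin n)) 1) := Metric.isOpen_ball
  have hx' : x ∈ Metric.ball (0 : EuclideanSpace ℝ (Fin n)) 1 := mem_ball_zero_iff.2 hx
  have hS := slitSmooth_funkNorm (n := n)
  set Du : EuclideanSpace ℝ (Fin n) → EuclideanSpace ℝ (Fin n) → ℝ :=
    fun x y => ∑ i, dY i funkNorm x y * u i with hDu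
  have hDuS : SlitSmooth (Metric.ball 0 1) Du :=
    SlitSmooth.sum fun i => (hS.dY hU i).mul (slitSmooth_const _)
  have h1 : ∀ z ≠ 0, Du x z * ((1 - ‖x‖ ^ 2) * funkNorm x z - inner ℝ x z) =
      funkNorm x z * inner ℝ x u + inner ℝ z u := fun z hz => by
    rw [← fderiv_funkNorm_right hx hz u, fderiv_right_eq_sum]
  have hF := (hS.hasFDerivAt_right hU hx' hy).differentiableAt.hasFDerivAt
  have hD := (hDuS.hasFDerivAt_right hU hx' hy).differentiableAt.hasFDerivAt
  have hl : (fun z => Du x z * ((1 - ‖x‖ ^ 2) * funkNorm x z - inner ℝ x z)) =ᶠ[𝓝 y]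
      fun z => funkNorm x z * inner ℝ x u + inner ℝ z u := by
    filter_upwards [isOpen_compl_singleton.mem_nhds hy] with z hz using h1 z hz
  have h2 := (hD.mul ((hF.const_mul (1 - ‖x‖ ^ 2)).sub
    ((hasFDerivAt_const x y).inner ℝ (hasFDerivAt_id y)))).unique
    (((hF.mul_const (inner ℝ x u)).add
      ((hasFDerivAt_id y).inner ℝ (hasFDerivAt_const u y))).congr_of_eventuallyEq hl)
  have h3 := DFunLike.congr_fun h2 u
  set c := fderiv ℝ (fun z => Du x z) y u with hc
  have hFu : fderiv ℝ (fun z => funkNorm x z) y u = Du x y := fderiv_right_eq_sum u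
  simp [hFu, ← hc] at h3
  have hcs : c = ∑ i, ∑ j, dY j (dY i funkNorm) x y * u i * u j := by
    rw [hc, fderiv_right_eq_sum, Finset.sum_comm]
    refine Finset.sum_congr rfl fun j _ => ?_
    rw [hDu, dY_sum hU hx' hy fun i => (hS.dY hU i).mul (slitSmooth_const _), Finset.sum_mul]
    refine Finset.sum_congr rfl fun i _ => ?_
    rw [dY_mul hU hx' hy (hS.dY hU i) (slitSmooth_const _), dY_const]
    ring
  have hform : fundForm funkNorm x y u u = Du x y ^ 2 + funkNorm x y * c := by
    rw [hcs, hDu, pow_two, Finset.sum_mul_sum]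
    simp only [fundForm, Finset.mul_sum, ← Finset.sum_add_distrib,
      IsFunkType.fundTensor_eq_of_slitSmooth hx' hy hU hS]
    refine Finset.sum_congr rfl fun i _ => Finset.sum_congr rfl fun j _ => ?_
    ring
  have hq := mul_funkNorm_sub_inner_pos hx hy
  have hp := funkNorm_pos hx hy
  have hn := norm_funkNorm_smul_add hx y
  have hh := h1 y hy
  set F := funkNorm x y with hFdef
  set d := Du x y with hd
  set z := F • x + y with hz
  set q := (1 - ‖x‖ ^ 2) * F - inner ℝ x y with hqdef
  have hcq : c * q = ‖d • x + u‖ ^ 2 - d ^ 2 := by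
    rw [norm_smul_add_sq]
    linear_combination h3
  have hdz : F * d = inner ℝ z (d • x + u) := by
    rw [hz, inner_add_left, inner_add_right, inner_add_right, inner_smul_left, inner_smul_left,
      inner_smul_right, inner_smul_right, real_inner_self_eq_norm_sq, real_inner_comm x y]
    simp
    linear_combination hh
  have hdle : |d| ≤ ‖d • x + u‖ := by
    have := abs_real_inner_le_norm z (d • x + u)
    rw [← hdz, hn, abs_mul, abs_of_pos hp] at this
    exact le_of_mul_le_mul_left this hp
  have hc0 : 0 ≤ c := by
    refine nonneg_of_mul_nonneg_left ?_ hq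
    rw [hcq, ← sq_abs d]
    have := pow_le_pow_left₀ (abs_nonneg d) hdle 2
    linarith
  rw [hform]
  -- If `d = 0`, then `c q = ‖u‖² > 0`; otherwise `d²` already suffices.
  by_cases hd0 : d = 0
  · have : 0 < c * q := by
      rw [hcq, hd0]
      simpa using pow_pos (norm_pos_iff.2 hu) 2
    have := pos_of_mul_pos_left this hq.le
    positivity
  · positivity

theorem isFunkType_funkNorm :
    IsFunkType (Metric.ball 0 1) (funkNorm : EuclideanSpace ℝ (Fin n) → _ → ℝ) where
  isOpen := Metric.isOpen_ball
  smooth := slitSmooth_funkNorm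
  euler x hx y hy := by
    have hx' := mem_ball_zero_iff.1 hx
    rw [← fderiv_right_eq_sum]
    apply mul_right_cancel₀ (mul_funkNorm_sub_inner_pos hx' hy).ne'
    rw [fderiv_funkNorm_right hx' hy, real_inner_self_eq_norm_sq]
    linear_combination - funkNorm_quadratic hx' y
  okada x hx y hy k := by
    have hx' := mem_ball_zero_iff.1 hx
    apply mul_right_cancel₀ (mul_funkNorm_sub_inner_pos hx' hy).ne'
    rw [mul_assoc]
    simp only [dX, dY]
    rw [fderiv_funkNorm_left hx' hy, fderiv_funkNorm_right hx' hy]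
  posDef x hx y hy u hu := fundForm_funkNorm_pos (mem_ball_zero_iff.1 hx) hy hu

end FunkNorm
-- The ball as a Finsler manifold
section Ball

variable {n : ℕ}

theorem mem_unitBall {x : EuclideanSpace ℝ (Fin n)} : x ∈ unitBall n ↔ ‖x‖ < 1 :=
  mem_ball_zero_iff

theorem norm_coe_lt_one (p : unitBall n) : ‖(p : EuclideanSpace ℝ (Fin n))‖ < 1 :=
  mem_unitBall.1 p.2

theorem extChartAt_unitBall_coe (p : unitBall n) :
    (extChartAt (𝓡 n) p : unitBall n → EuclideanSpace ℝ (Fin n)) = Subtype.val := rfl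

theorem extChartAt_unitBall_source (p : unitBall n) :
    (extChartAt (𝓡 n) p).source = Set.univ := by
  simp only [TopologicalSpace.Opens.chartAt_eq, chartAt_self_eq, mfld_simps]

theorem extChartAt_unitBall_target (p : unitBall n) :
    (extChartAt (𝓡 n) p).target = Metric.ball 0 1 := by
  rw [← (extChartAt (𝓡 n) p).image_source_eq_target, extChartAt_unitBall_source,
    extChartAt_unitBall_coe, Set.image_univ, Subtype.range_coe]
  rfl

theorem coe_extChartAt_unitBall_symm (p : unitBall n) {x : EuclideanSpace ℝ (Fin n)}
    (hx : ‖x‖ < 1) : ((extChartAt (𝓡 n) p).symm x : EuclideanSpace ℝ (Fin n)) = x := by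
  have : x ∈ (extChartAt (𝓡 n) p).target := by
    rw [extChartAt_unitBall_target]
    exact mem_ball_zero_iff.2 hx
  exact (extChartAt (𝓡 n) p).right_inv this

/-- Every chart of the ball is the inclusion, so inclusion after inverse chart is the identity near
`x`, and the chain rule makes the two tangent maps cancel. -/
theorem chartRep_funkMetric (p : unitBall n) {x : EuclideanSpace ℝ (Fin n)} (hx : ‖x‖ < 1)
    (y : EuclideanSpace ℝ (Fin n)) : chartRep (funkMetric n) p x y = funkNorm x y := by
  have hxt : x ∈ (extChartAt (𝓡 n) p).target := by
    rw [extChartAt_unitBall_target]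
    exact mem_ball_zero_iff.2 hx
  have ho : IsOpen (extChartAt (𝓡 n) p).target := isOpen_extChartAt_target p
  have h1 : MDifferentiableAt 𝓘(ℝ, EuclideanSpace ℝ (Fin n)) (𝓡 n)
      (extChartAt (𝓡 n) p).symm x :=
    ((contMDiffOn_extChartAt_symm (n := 1) p).contMDiffAt (ho.mem_nhds hxt)).mdifferentiableAt
      one_ne_zero
  have h2 : MDifferentiableAt (𝓡 n) 𝓘(ℝ, EuclideanSpace ℝ (Fin n))
      (Subtype.val : unitBall n → EuclideanSpace ℝ (Fin n)) ((extChartAt (𝓡 n) p).symm x) :=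
    (contMDiff_subtype_val (n := 1)).mdifferentiableAt one_ne_zero
  have h3 : (Subtype.val ∘ (extChartAt (𝓡 n) p).symm) =ᶠ[𝓝 x] id := by
    filter_upwards [ho.mem_nhds hxt] with z hz
    rw [extChartAt_unitBall_target, mem_ball_zero_iff] at hz
    exact coe_extChartAt_unitBall_symm p hz
  have h4 := mfderiv_comp x h2 h1
  rw [h3.mfderiv_eq, mfderiv_id] at h4
  have h5 := DFunLike.congr_fun h4 y
  rw [chartRep, funkMetric]
  dsimp only
  rw [coe_extChartAt_unitBall_symm p hx]
  congr 1
  exact h5.symm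

theorem isFunkType_chartRep (p : unitBall n) :
    IsFunkType (Metric.ball 0 1) (chartRep (funkMetric n) p) :=
  isFunkType_funkNorm.congr fun _ hx y _ => chartRep_funkMetric p (mem_ball_zero_iff.1 hx) y

theorem hasConstantFlagCurvature_funkMetric :
    HasConstantFlagCurvature (funkMetric n) (-1 / 4) := fun p _ _ hvu =>
  (isFunkType_chartRep p).localFlagCurv_eq p.2 (hvu.ne_zero 0) hvu

/-- The inverse chart provides a left inverse by the chain rule. It ensures that nonzero tangent
vectors have nonzero coordinates, where the Funk norm is smooth. -/
theorem mfderiv_unitBall_coe_injective (p : unitBall n) :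
    Function.Injective (mfderiv (𝓡 n) 𝓘(ℝ, EuclideanSpace ℝ (Fin n))
      (Subtype.val : unitBall n → EuclideanSpace ℝ (Fin n)) p) := by
  have h2 : MDifferentiableAt (𝓡 n) 𝓘(ℝ, EuclideanSpace ℝ (Fin n))
      (Subtype.val : unitBall n → EuclideanSpace ℝ (Fin n)) p :=
    (contMDiff_subtype_val (n := 1)).mdifferentiableAt one_ne_zero
  have ho : IsOpen (extChartAt (𝓡 n) p).target := isOpen_extChartAt_target p
  have h1 : MDifferentiableAt 𝓘(ℝ, EuclideanSpace ℝ (Fin n)) (𝓡 n)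
      (extChartAt (𝓡 n) p).symm (p : EuclideanSpace ℝ (Fin n)) :=
    ((contMDiffOn_extChartAt_symm (n := 1) p).contMDiffAt
      (ho.mem_nhds (mem_extChartAt_target p))).mdifferentiableAt one_ne_zero
  have h3 : (extChartAt (𝓡 n) p).symm ∘ Subtype.val = id := by
    ext q : 1
    exact (extChartAt (𝓡 n) p).left_inv (by
      rw [extChartAt_unitBall_source]
      trivial)
  have h4 := mfderiv_comp p h1 h2
  rw [h3, mfderiv_id] at h4
  intro v w hvw
  have hv := DFunLike.congr_fun h4 v
  have hw := DFunLike.congr_fun h4 w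
  refine hv.trans (Eq.trans ?_ hw.symm)
  exact congrArg (mfderiv 𝓘(ℝ, EuclideanSpace ℝ (Fin n)) (𝓡 n) (extChartAt (𝓡 n) p).symm
    (p : EuclideanSpace ℝ (Fin n))) hvw

/-- The coordinates on the tangent bundle of the unit ball given by the inclusion into `ℝⁿ`. -/
noncomputable def tangentCoords (v : TangentBundle (𝓡 n) (unitBall n)) :
    EuclideanSpace ℝ (Fin n) × EuclideanSpace ℝ (Fin n) :=
  (v.1, mfderiv (𝓡 n) 𝓘(ℝ, EuclideanSpace ℝ (Fin n))
    (Subtype.val : unitBall n → EuclideanSpace ℝ (Fin n)) v.1 v.2)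

theorem funkMetric_eq :
    funkMetric n = fun v => funkNorm (tangentCoords v).1 (tangentCoords v).2 := rfl

theorem contMDiff_tangentCoords :
    ContMDiff (𝓡 n).tangent 𝓘(ℝ, EuclideanSpace ℝ (Fin n) × EuclideanSpace ℝ (Fin n)) ∞
      (tangentCoords (n := n)) := by
  have h1 : ContMDiff (𝓡 n) 𝓘(ℝ, EuclideanSpace ℝ (Fin n)) ∞
      (Subtype.val : unitBall n → EuclideanSpace ℝ (Fin n)) := contMDiff_subtype_val
  have h2 := h1.contMDiff_tangentMap (m := ∞) (by simp)
  refine ContMDiff.prodMk_space (h1.comp (Bundle.contMDiff_proj _)) ?_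
  exact (contMDiff_snd_tangentBundle_modelSpace (EuclideanSpace ℝ (Fin n))
    𝓘(ℝ, EuclideanSpace ℝ (Fin n))).comp h2

theorem tangentCoords_mem_ball (v : TangentBundle (𝓡 n) (unitBall n)) :
    (tangentCoords v).1 ∈ Metric.ball (0 : EuclideanSpace ℝ (Fin n)) 1 := v.1.2

theorem tangentCoords_snd_ne_zero {v : TangentBundle (𝓡 n) (unitBall n)} (hv : v.2 ≠ 0) :
    (tangentCoords v).2 ≠ 0 := fun h0 =>
  hv (mfderiv_unitBall_coe_injective v.1 (h0.trans (map_zero _).symm))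

theorem continuous_funkMetric : Continuous (funkMetric n) := by
  rw [funkMetric_eq]
  exact continuousOn_funkNorm.comp_continuous (contMDiff_tangentCoords (n := n)).continuous
    fun v => Set.mk_mem_prod (tangentCoords_mem_ball v) (Set.mem_univ _)

theorem contMDiffOn_funkMetric :
    ContMDiffOn (𝓡 n).tangent 𝓘(ℝ, ℝ) ∞ (funkMetric n) {v | v.2 ≠ 0} := by
  have h : ContMDiffOn 𝓘(ℝ, EuclideanSpace ℝ (Fin n) × EuclideanSpace ℝ (Fin n)) 𝓘(ℝ, ℝ) ∞
      (fun q : EuclideanSpace ℝ (Fin n) × EuclideanSpace ℝ (Fin n) => funkNorm q.1 q.2)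
      (Metric.ball 0 1 ×ˢ {0}ᶜ) := ContDiffOn.contMDiffOn slitSmooth_funkNorm
  rw [funkMetric_eq]
  exact h.comp contMDiff_tangentCoords.contMDiffOn
    fun v hv => Set.mk_mem_prod (tangentCoords_mem_ball v) (tangentCoords_snd_ne_zero hv)

theorem funkMetric_smul (p : unitBall n) (v : TangentSpace (𝓡 n) p) {t : ℝ} (ht : 0 ≤ t) :
    funkMetric n ⟨p, t • v⟩ = t * funkMetric n ⟨p, v⟩ := by
  rw [funkMetric, funkMetric, map_smul]
  exact funkNorm_smul (norm_coe_lt_one p) ht _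

theorem isFinslerMetric_funkMetric : IsFinslerMetric (funkMetric n) where
  continuous := continuous_funkMetric
  nonneg v := funkNorm_nonneg (norm_coe_lt_one v.1) _
  smooth := contMDiffOn_funkMetric
  homogeneous p v _ ht := funkMetric_smul p v ht
  posDef p v u hv hu := (isFunkType_chartRep p).posDef _ p.2 v hv u hu

/-- A compact ball would be clopen in the connected space `ℝⁿ`, hence all of it. -/
theorem noncompactSpace_unitBall (hn : 2 ≤ n) : NoncompactSpace (unitBall n) := by
  rw [← not_compactSpace_iff]
  intro hc
  have : Nonempty (Fin n) := ⟨⟨0, by omega⟩⟩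
  have h1 : IsCompact (Metric.ball (0 : EuclideanSpace ℝ (Fin n)) 1) :=
    isCompact_iff_compactSpace.2 hc
  have h2 : IsClopen (Metric.ball (0 : EuclideanSpace ℝ (Fin n)) 1) :=
    ⟨h1.isClosed, Metric.isOpen_ball⟩
  rcases isClopen_iff.1 h2 with h | h
  · exact (Metric.nonempty_ball.2 one_pos).ne_empty h
  · exact NormedSpace.noncompactSpace ℝ (EuclideanSpace ℝ (Fin n)) |>.noncompact_univ (h ▸ h1)

theorem simplyConnectedSpace_unitBall : SimplyConnectedSpace (unitBall n) := by
  have : ContractibleSpace (unitBall n) :=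
    (convex_ball (0 : EuclideanSpace ℝ (Fin n)) 1).contractibleSpace
      (Metric.nonempty_ball.2 one_pos)
  infer_instance

end Ball
-- Geodesics and forward completeness
section Geodesics

variable {n : ℕ}

theorem contMDiffOn_unitBall_iff {σ : ℝ → unitBall n} {S : Set ℝ} :
    ContMDiffOn 𝓘(ℝ, ℝ) (𝓡 n) ∞ σ S ↔
      ContDiffOn ℝ ∞ (fun t => (σ t : EuclideanSpace ℝ (Fin n))) S := by
  rw [← contMDiffOn_iff_contDiffOn]
  exact forall₂_congr fun t _ => (ContMDiffWithinAt.subtypeVal_comp_iff (unitBall n) σ S t).symm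

/-- The geodesic equation of the Funk metric is `c̈ = -F(c, ċ) ċ`. -/
theorem isGeodesicOn_funkMetric_iff {σ : ℝ → unitBall n} {S : Set ℝ}
    {c : ℝ → EuclideanSpace ℝ (Fin n)} (hc : c = fun t => (σ t : EuclideanSpace ℝ (Fin n))) :
    IsGeodesicOn (funkMetric n) σ S ↔ ContDiffOn ℝ ∞ c S ∧
      ∀ t ∈ S, derivWithin (derivWithin c S) S t =
        -(funkNorm (c t) (derivWithin c S t) • derivWithin c S t) := by
  have key : ∀ (p : unitBall n) (t : ℝ) (y : EuclideanSpace ℝ (Fin n)) (i : Fin n),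
      ∑ j, ∑ k, chernCoeff (chartRep (funkMetric n) p) i j k (σ t) y * y j * y k =
        funkNorm (c t) y * y i := by
    intro p t y i
    rw [hc]
    have hct := norm_coe_lt_one (σ t)
    rcases eq_or_ne y 0 with rfl | hy
    -- The coefficients are not controlled at `y = 0`, but they are multiplied by zero there.
    · simp
    · rw [(isFunkType_chartRep p).sum_chernCoeff_mul_mul (mem_ball_zero_iff.2 hct) hy,
        chartRep_funkMetric p hct]
  rw [IsGeodesicOn, contMDiffOn_unitBall_iff, ← hc]
  refine and_congr_right fun _ => ⟨fun h t ht => ?_, fun h p t ht _ i => ?_⟩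
  · ext i
    have h1 := h (σ t) t ht (mem_extChartAt_source (σ t)) i
    simp only [extChartAt_unitBall_coe, ← hc] at h1
    rw [key] at h1
    simpa using eq_neg_of_add_eq_zero_left h1
  · simp only [extChartAt_unitBall_coe, ← hc]
    rw [key, h t ht]
    simp

theorem isGeodesicOn_const (p : unitBall n) (S : Set ℝ) :
    IsGeodesicOn (funkMetric n) (fun _ => p) S := by
  rw [isGeodesicOn_funkMetric_iff rfl]
  refine ⟨contDiffOn_const, fun t _ => ?_⟩
  have : derivWithin (fun _ : ℝ => (p : EuclideanSpace ℝ (Fin n))) S = fun _ => 0 :=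
    funext fun t => by simp
  rw [this]
  simp

/-- With `l = F(x, v)` and `e = exp(-lt)`, the point is the convex combination `e x + (1 - e)(x + v
/ l)` of `x` and a boundary point, with `e > 0`. The speed is `l` because `l c + e v = l x + v` has
norm `l`. -/
theorem funkNorm_line {x v : EuclideanSpace ℝ (Fin n)} (hx : ‖x‖ < 1) (hv : v ≠ 0) {t : ℝ}
    (ht : 0 ≤ t) :
    ‖x + ((1 - Real.exp (-(funkNorm x v * t))) / funkNorm x v) • v‖ < 1 ∧
      funkNorm (x + ((1 - Real.exp (-(funkNorm x v * t))) / funkNorm x v) • v)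
        (Real.exp (-(funkNorm x v * t)) • v) = funkNorm x v := by
  have hl := funkNorm_pos hx hv
  have hn := norm_funkNorm_smul_add hx v
  set l := funkNorm x v
  have he : 0 < Real.exp (-(l * t)) := Real.exp_pos _
  have he1 : Real.exp (-(l * t)) ≤ 1 := Real.exp_le_one_iff.2 (by nlinarith)
  set e := Real.exp (-(l * t))
  have h1 : x + ((1 - e) / l) • v = e • x + ((1 - e) / l) • (l • x + v) := by
    rw [smul_add, smul_smul, div_mul_cancel₀ _ hl.ne']
    module
  have hlt : ‖x + ((1 - e) / l) • v‖ < 1 := by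
    calc ‖x + ((1 - e) / l) • v‖ ≤ ‖e • x‖ + ‖((1 - e) / l) • (l • x + v)‖ :=
          h1 ▸ norm_add_le _ _
      _ = e * ‖x‖ + (1 - e) := by
          rw [norm_smul, norm_smul, hn, Real.norm_of_nonneg he.le,
            Real.norm_of_nonneg (div_nonneg (by linarith) hl.le), div_mul_cancel₀ _ hl.ne']
      _ < 1 := by nlinarith
  refine ⟨hlt, (eq_funkNorm hlt hl.le ?_).symm⟩
  rw [smul_add, smul_smul, mul_div_cancel₀ _ hl.ne']
  refine Eq.trans ?_ hn
  congr 1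
  module

theorem hasDerivAt_exp_mul (k t : ℝ) :
    HasDerivAt (fun t => Real.exp (k * t)) (k * Real.exp (k * t)) t := by
  simpa [mul_comm] using ((hasDerivAt_id' t).const_mul k).exp

theorem exists_isGeodesicOn_line {x v : EuclideanSpace ℝ (Fin n)} (hx : ‖x‖ < 1) (hv : v ≠ 0) :
    ∃ τ : ℝ → unitBall n, IsGeodesicOn (funkMetric n) τ (Set.Ici 0) ∧ ∀ t, 0 ≤ t →
      (τ t : EuclideanSpace ℝ (Fin n)) =
        x + ((1 - Real.exp (-(funkNorm x v * t))) / funkNorm x v) • v := by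
  have hl := funkNorm_pos hx hv
  have hline := fun t ht => funkNorm_line hx hv (t := t) ht
  set l := funkNorm x v
  classical
  set c : ℝ → EuclideanSpace ℝ (Fin n) := fun t => x + ((1 - Real.exp (-(l * t))) / l) • v with hc
  have hτ : ∀ t, 0 ≤ t → c t ∈ unitBall n := fun t ht => mem_unitBall.2 (hline t ht).1
  -- For `t < 0` the formula may leave the ball; the value there is irrelevant, since derivatives
  -- are taken within `[0, ∞)`.
  refine ⟨fun t => if h : 0 ≤ t then ⟨c t, hτ t h⟩ else ⟨x, mem_unitBall.2 hx⟩, ?_, ?_⟩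
  swap
  · intro t ht
    simp [ht, hc]
  rw [isGeodesicOn_funkMetric_iff rfl]
  set c₁ : ℝ → EuclideanSpace ℝ (Fin n) := fun t => ((if h : 0 ≤ t then ⟨c t, hτ t h⟩ else
    ⟨x, mem_unitBall.2 hx⟩ : unitBall n) : EuclideanSpace ℝ (Fin n)) with hc₁
  have heq : Set.EqOn c₁ c (Set.Ici 0) := fun t ht => by
    have ht' : 0 ≤ t := ht
    simp only [hc₁, dif_pos ht']
  have he : ∀ t, HasDerivAt (fun t => Real.exp (-(l * t))) (-(l * Real.exp (-(l * t)))) t :=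
    fun t => by simpa using hasDerivAt_exp_mul (-l) t
  have hd : ∀ t, HasDerivAt c (Real.exp (-(l * t)) • v) t := fun t => by
    have := (((he t).const_sub 1).div_const l).smul_const v |>.const_add x
    have h2 : -(-(l * Real.exp (-(l * t)))) / l = Real.exp (-(l * t)) := by
      field_simp
    rwa [h2] at this
  have hd2 : ∀ t, HasDerivAt (fun t => Real.exp (-(l * t)) • v)
      (-(l * Real.exp (-(l * t))) • v) t := fun t => (he t).smul_const v
  have hu := uniqueDiffOn_Ici (0 : ℝ)
  have hw : Set.EqOn (derivWithin c₁ (Set.Ici 0)) (fun t => Real.exp (-(l * t)) • v)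
      (Set.Ici 0) := fun t ht => by
    rw [derivWithin_congr heq (heq ht), (hd t).hasDerivWithinAt.derivWithin (hu t ht)]
  refine ⟨?_, fun t ht => ?_⟩
  · refine ContDiffOn.congr (f := c) ?_ heq
    have : ContDiff ℝ ∞ c := by
      simp only [hc]
      fun_prop
    exact this.contDiffOn
  · rw [derivWithin_congr hw (hw ht), (hd2 t).hasDerivWithinAt.derivWithin (hu t ht), hw ht]
    change _ = -(funkNorm (c₁ t) (Real.exp (-(l * t)) • v) • Real.exp (-(l * t)) • v)
    rw [heq ht, (hline t ht).2, neg_smul, mul_smul]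

theorem eq_of_hasDerivWithinAt_Icc_zero {E : Type*} [NormedAddCommGroup E] [NormedSpace ℝ E]
    {a : ℝ} {f : ℝ → E} (h : ∀ t ∈ Set.Icc 0 a, HasDerivWithinAt f 0 (Set.Icc 0 a) t) :
    ∀ t ∈ Set.Icc 0 a, f t = f 0 :=
  constant_of_has_deriv_right_zero (fun t ht => (h t ht).continuousWithinAt) fun t ht =>
    (h t ⟨ht.1, ht.2.le⟩).mono_of_mem_nhdsWithin (Icc_mem_nhdsGE_of_mem ht)

theorem _root_.ContinuousOn.funkNorm {c w : ℝ → EuclideanSpace ℝ (Fin n)} {S : Set ℝ}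
    (hc : ContinuousOn c S) (hw : ContinuousOn w S) (hc1 : ∀ t ∈ S, ‖c t‖ < 1) :
    ContinuousOn (fun t => Finsler.funkNorm (c t) (w t)) S := by
  have h := ContinuousOn.comp
    (g := fun q : EuclideanSpace ℝ (Fin n) × EuclideanSpace ℝ (Fin n) => Finsler.funkNorm q.1 q.2)
    (f := fun t => (c t, w t)) continuousOn_funkNorm (hc.prodMk hw)
    fun t ht => Set.mk_mem_prod (mem_ball_zero_iff.2 (hc1 t ht)) (Set.mem_univ _)
  simpa only [Function.comp_def] using h

/-- Conservation of speed: the derivative is `F_x(w) - F F_y(w)`, and both terms equal `F²` by Okada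
and Euler. -/
theorem hasDerivWithinAt_funkNorm {c w : ℝ → EuclideanSpace ℝ (Fin n)} {S : Set ℝ} {t : ℝ}
    (hc : HasDerivWithinAt c (w t) S t)
    (hw : HasDerivWithinAt w (-(funkNorm (c t) (w t) • w t)) S t) (hct : ‖c t‖ < 1)
    (hwt : w t ≠ 0) : HasDerivWithinAt (fun s => funkNorm (c s) (w s)) 0 S t := by
  have hball := mem_ball_zero_iff.2 hct
  have hL := isFunkType_funkNorm (n := n)
  have h1 := (hL.smooth.hasFDerivAt hL.isOpen hball hwt).comp_hasDerivWithinAt t (hc.prodMk hw)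
  have h2 : (w t, -(funkNorm (c t) (w t) • w t)) =
      (w t, 0) + (-funkNorm (c t) (w t)) • ((0, w t) : EuclideanSpace ℝ (Fin n) × _) := by
    simp
  have h3 : fderiv ℝ (fun z => funkNorm z (w t)) (c t) (w t) =
      fderiv ℝ (fun q : EuclideanSpace ℝ (Fin n) × EuclideanSpace ℝ (Fin n) => funkNorm q.1 q.2)
        (c t, w t) (w t, 0) := by
    simp [(hL.smooth.hasFDerivAt_left hL.isOpen hball hwt).fderiv]
  have h4 : fderiv ℝ (fun z => funkNorm (c t) z) (w t) (w t) =
      fderiv ℝ (fun q : EuclideanSpace ℝ (Fin n) × EuclideanSpace ℝ (Fin n) => funkNorm q.1 q.2)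
        (c t, w t) (0, w t) := by
    simp [(hL.smooth.hasFDerivAt_right hL.isOpen hball hwt).fderiv]
  rw [h2, map_add, map_smul, ← h3, ← h4, fderiv_left_eq_sum, fderiv_right_eq_sum,
    hL.euler _ hball _ hwt] at h1
  have h5 : ∑ k, dX k funkNorm (c t) (w t) * w t k =
      funkNorm (c t) (w t) * funkNorm (c t) (w t) := by
    simp only [hL.okada _ hball _ hwt, mul_assoc, ← Finset.mul_sum, hL.euler _ hball _ hwt]
  rw [h5, smul_eq_mul, neg_mul, add_neg_cancel] at h1
  exact h1

/-- A velocity field along a geodesic keeps its direction. -/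
theorem exists_eq_exp_smul {a : ℝ} (ha : 0 < a) {φ : ℝ → ℝ} {w : ℝ → EuclideanSpace ℝ (Fin n)}
    (hφ : ContinuousOn φ (Set.Icc 0 a))
    (hw : ∀ t ∈ Set.Icc 0 a, HasDerivWithinAt w (-(φ t • w t)) (Set.Icc 0 a) t) :
    ∃ Φ : ℝ → ℝ, ∀ t ∈ Set.Icc 0 a, w t = Real.exp (-Φ t) • w 0 := by
  -- Extending `φ` constantly beyond `[0, a]` gives a primitive `Φ` differentiable everywhere; `exp
  -- Φ` is then an integrating factor.
  have hcont : Continuous (Set.IccExtend ha.le ((Set.Icc 0 a).domRestrict φ)) :=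
    (continuousOn_iff_continuous_domRestrict.1 hφ).Icc_extend'
  set Φ : ℝ → ℝ := fun t => ∫ s in (0 : ℝ)..t, Set.IccExtend ha.le ((Set.Icc 0 a).domRestrict φ) s
    with hΦ
  have hΦd : ∀ t ∈ Set.Icc 0 a, HasDerivAt Φ (φ t) t := fun t ht => by
    have := (hcont.integral_hasStrictDerivAt 0 t).hasDerivAt
    rwa [Set.IccExtend_of_mem _ _ ht] at this
  have hconst := eq_of_hasDerivWithinAt_Icc_zero (f := fun t => Real.exp (Φ t) • w t)
    fun t ht => (((hΦd t ht).exp.hasDerivWithinAt).smul (hw t ht)).congr_deriv (by module)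
  refine ⟨Φ, fun t ht => ?_⟩
  have h1 := hconst t ht
  have h0 : Φ 0 = 0 := intervalIntegral.integral_same
  simp only [h0, Real.exp_zero, one_smul] at h1
  rw [← h1, smul_smul, ← Real.exp_add]
  simp

theorem eq_exp_smul_of_hasDerivWithinAt {a l : ℝ} {w : ℝ → EuclideanSpace ℝ (Fin n)}
    (hw : ∀ t ∈ Set.Icc 0 a, HasDerivWithinAt w (-(l • w t)) (Set.Icc 0 a) t) :
    ∀ t ∈ Set.Icc 0 a, w t = Real.exp (-l * t) • w 0 := by
  intro t ht
  have h1 := eq_of_hasDerivWithinAt_Icc_zero (f := fun t => Real.exp (l * t) • w t)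
    (fun t ht => (((hasDerivAt_exp_mul l t).hasDerivWithinAt).smul (hw t ht)).congr_deriv
      (by module)) t ht
  simp only [mul_zero, Real.exp_zero, one_smul] at h1
  rw [← h1, smul_smul, ← Real.exp_add]
  simp

theorem eq_line_of_hasDerivWithinAt {a l : ℝ} (hl : l ≠ 0) {c : ℝ → EuclideanSpace ℝ (Fin n)}
    {v : EuclideanSpace ℝ (Fin n)}
    (hc : ∀ t ∈ Set.Icc 0 a, HasDerivWithinAt c (Real.exp (-l * t) • v) (Set.Icc 0 a) t) :
    ∀ t ∈ Set.Icc 0 a, c t = c 0 + ((1 - Real.exp (-(l * t))) / l) • v := by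
  intro t ht
  have h1 := eq_of_hasDerivWithinAt_Icc_zero
    (f := fun t => c t + (Real.exp (-l * t) / l) • v) (fun t ht => by
      have := (hc t ht).add
        ((((hasDerivAt_exp_mul (-l) t).div_const l).smul_const v).hasDerivWithinAt
          (s := Set.Icc 0 a))
      have h2 : -l * Real.exp (-l * t) / l = -Real.exp (-l * t) := by field_simp
      rwa [h2, neg_smul, add_neg_cancel] at this) t ht
  simp only [mul_zero, Real.exp_zero] at h1
  rw [eq_sub_of_add_eq h1, neg_mul, sub_div]
  module

/-- The solutions of the geodesic equation of the Funk metric. -/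
theorem eq_line_of_geodesic_equation {a : ℝ} (ha : 0 < a) {c w : ℝ → EuclideanSpace ℝ (Fin n)}
    (hc1 : ∀ t, ‖c t‖ < 1) (hwc : ContinuousOn w (Set.Icc 0 a))
    (hcd : ∀ t ∈ Set.Icc 0 a, HasDerivWithinAt c (w t) (Set.Icc 0 a) t)
    (hwd : ∀ t ∈ Set.Icc 0 a,
      HasDerivWithinAt w (-(funkNorm (c t) (w t) • w t)) (Set.Icc 0 a) t) :
    ∀ t ∈ Set.Icc 0 a, c t =
      c 0 + ((1 - Real.exp (-(funkNorm (c 0) (w 0) * t))) / funkNorm (c 0) (w 0)) • w 0 := by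
  have hcc : ContinuousOn c (Set.Icc 0 a) := fun t ht => (hcd t ht).continuousWithinAt
  have hφ : ContinuousOn (fun t => funkNorm (c t) (w t)) (Set.Icc 0 a) :=
    hcc.funkNorm hwc fun t _ => hc1 t
  -- The velocity is thus identically zero or never zero. This has to precede conservation of speed,
  -- which differentiates `F` away from `y = 0`.
  obtain ⟨Φ, hΦ⟩ := exists_eq_exp_smul ha hφ hwd
  rcases eq_or_ne (w 0) 0 with h0 | h0
  · intro t ht
    rw [h0, smul_zero, add_zero]
    refine eq_of_hasDerivWithinAt_Icc_zero (f := c) (fun t ht => ?_) t ht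
    have := hcd t ht
    rwa [hΦ t ht, h0, smul_zero] at this
  · have hw0 : ∀ t ∈ Set.Icc 0 a, w t ≠ 0 := fun t ht => by
      rw [hΦ t ht]
      exact smul_ne_zero (Real.exp_pos _).ne' h0
    have hspeed : ∀ t ∈ Set.Icc 0 a, funkNorm (c t) (w t) = funkNorm (c 0) (w 0) :=
      eq_of_hasDerivWithinAt_Icc_zero (f := fun t => funkNorm (c t) (w t)) fun t ht =>
        hasDerivWithinAt_funkNorm (hcd t ht) (hwd t ht) (hc1 t) (hw0 t ht)
    have hl := funkNorm_pos (hc1 0) h0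
    have hwexp := eq_exp_smul_of_hasDerivWithinAt (l := funkNorm (c 0) (w 0)) fun t ht => by
      rw [← hspeed t ht]
      exact hwd t ht
    exact eq_line_of_hasDerivWithinAt hl.ne' fun t ht => by
      rw [← hwexp t ht]
      exact hcd t ht

theorem forwardComplete_funkMetric : ForwardComplete (funkMetric n) := by
  intro a σ ha hσ
  obtain ⟨hsm, hgeo⟩ := (isGeodesicOn_funkMetric_iff rfl).1 hσ
  have hu : UniqueDiffOn ℝ (Set.Icc 0 a) := uniqueDiffOn_Icc ha
  have hwsm := hsm.derivWithin hu (m := ∞) (by simp)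
  have hline := eq_line_of_geodesic_equation ha (fun t => norm_coe_lt_one (σ t))
    hwsm.continuousOn
    (fun t ht => ((hsm.differentiableOn (by simp)) t ht).hasDerivWithinAt)
    (fun t ht => by
      rw [← hgeo t ht]
      exact ((hwsm.differentiableOn (by simp)) t ht).hasDerivWithinAt)
  rcases eq_or_ne (derivWithin (fun t => (σ t : EuclideanSpace ℝ (Fin n))) (Set.Icc 0 a) 0) 0
    with h0 | h0
  · refine ⟨fun _ => σ 0, isGeodesicOn_const _ _, fun t ht => Subtype.ext ?_⟩
    rw [hline t ht, h0, smul_zero, add_zero]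
  · obtain ⟨τ, hτ, hτe⟩ := exists_isGeodesicOn_line (norm_coe_lt_one (σ 0)) h0
    exact ⟨τ, hτ, fun t ht => Subtype.ext ((hτe t ht.1).trans (hline t ht).symm)⟩

end Geodesics
-- Lower bounds for the Funk distance
section Distance

variable {n : ℕ}

theorem funkMetric_mfderiv {σ : ℝ → unitBall n} {t : ℝ}
    (hσ : MDifferentiableAt 𝓘(ℝ, ℝ) (𝓡 n) σ t) :
    funkMetric n ⟨σ t, mfderiv 𝓘(ℝ, ℝ) (𝓡 n) σ t (1 : ℝ)⟩ =
      funkNorm (σ t : EuclideanSpace ℝ (Fin n))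
        (deriv (fun t => (σ t : EuclideanSpace ℝ (Fin n))) t) := by
  have h2 : MDifferentiableAt (𝓡 n) 𝓘(ℝ, EuclideanSpace ℝ (Fin n))
      (Subtype.val : unitBall n → EuclideanSpace ℝ (Fin n)) (σ t) :=
    (contMDiff_subtype_val (n := 1)).mdifferentiableAt one_ne_zero
  have h3 := DFunLike.congr_fun (mfderiv_comp t h2 hσ) (1 : ℝ)
  rw [mfderiv_eq_fderiv] at h3
  rw [← fderiv_apply_one_eq_deriv]
  exact congrArg (funkNorm (σ t : EuclideanSpace ℝ (Fin n))) h3.symm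

/-- Calibration: if `dh ≤ F`, then `h` grows along a curve by at most its length. Integrability is
carried along because it is needed to add up the smooth pieces. -/
theorem intervalIntegrable_and_sub_le_integral {h : EuclideanSpace ℝ (Fin n) → ℝ}
    {h' : EuclideanSpace ℝ (Fin n) → EuclideanSpace ℝ (Fin n) →L[ℝ] ℝ}
    (hd : ∀ x, ‖x‖ < 1 → HasFDerivAt h (h' x) x)
    (hle : ∀ x v, ‖x‖ < 1 → h' x v ≤ funkNorm x v) {σ : ℝ → unitBall n} {a b : ℝ} (hab : a ≤ b)
    (hσ : ContMDiffOn 𝓘(ℝ, ℝ) (𝓡 n) ∞ σ (Set.Icc a b)) :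
    IntervalIntegrable (fun t => funkMetric n ⟨σ t, mfderiv 𝓘(ℝ, ℝ) (𝓡 n) σ t (1 : ℝ)⟩)
        MeasureTheory.volume a b ∧
      h (σ b) - h (σ a) ≤
        ∫ t in a..b, funkMetric n ⟨σ t, mfderiv 𝓘(ℝ, ℝ) (𝓡 n) σ t (1 : ℝ)⟩ := by
  rcases hab.eq_or_lt with rfl | hlt
  · simp
  have hc := contMDiffOn_unitBall_iff.1 hσ
  have hc1 : ∀ t, ‖(σ t : EuclideanSpace ℝ (Fin n))‖ < 1 := fun t => norm_coe_lt_one (σ t)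
  set g : ℝ → ℝ := fun t => funkMetric n ⟨σ t, mfderiv 𝓘(ℝ, ℝ) (𝓡 n) σ t (1 : ℝ)⟩ with hg
  set c : ℝ → EuclideanSpace ℝ (Fin n) := fun t => σ t with hcdef
  have hw : ContinuousOn (derivWithin c (Set.Icc a b)) (Set.Icc a b) :=
    (hc.derivWithin (uniqueDiffOn_Icc hlt) (m := ∞) (by simp)).continuousOn
  -- At the end points the two-sided `mfderiv` need not be the one-sided velocity, so the integrand
  -- is identified on the open interval only.
  have hgc : ∀ t ∈ Set.Ioo a b, g t = funkNorm (c t) (derivWithin c (Set.Icc a b) t) := by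
    intro t ht
    have hn := Icc_mem_nhds ht.1 ht.2
    rw [hg, derivWithin_of_mem_nhds hn]
    exact funkMetric_mfderiv ((hσ.contMDiffAt hn).mdifferentiableAt (by simp))
  have hint : MeasureTheory.IntegrableOn g (Set.Icc a b) := by
    rw [integrableOn_Icc_iff_integrableOn_Ioo]
    refine MeasureTheory.IntegrableOn.congr_fun ?_ (fun t ht => (hgc t ht).symm) measurableSet_Ioo
    exact ((hc.continuousOn.funkNorm hw fun t _ => hc1 t).integrableOn_Icc).mono_set
      Set.Ioo_subset_Icc_self
  refine ⟨(intervalIntegrable_iff_integrableOn_Icc_of_le hab).2 hint, ?_⟩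
  refine intervalIntegral.sub_le_integral_of_hasDeriv_right_of_le (g := fun t => h (c t))
    (g' := fun t => h' (c t) (derivWithin c (Set.Icc a b) t)) hab ?_ ?_ hint ?_
  · exact fun t ht => ContinuousAt.comp_continuousWithinAt (g := h) (f := c)
      (hd _ (hc1 t)).continuousAt (hc.continuousOn t ht)
  · intro t ht
    have hn := Icc_mem_nhds ht.1 ht.2
    have h1 : HasDerivAt c (derivWithin c (Set.Icc a b) t) t :=
      ((hc.differentiableOn (by simp)) t ⟨ht.1.le, ht.2.le⟩).hasDerivWithinAt.hasDerivAt hn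
    exact ((hd _ (hc1 t)).comp_hasDerivAt t h1).hasDerivWithinAt
  · intro t ht
    exact (hle _ _ (hc1 t)).trans (hgc t ht).ge

theorem sub_le_curveLength {h : EuclideanSpace ℝ (Fin n) → ℝ}
    {h' : EuclideanSpace ℝ (Fin n) → EuclideanSpace ℝ (Fin n) →L[ℝ] ℝ}
    (hd : ∀ x, ‖x‖ < 1 → HasFDerivAt h (h' x) x)
    (hle : ∀ x v, ‖x‖ < 1 → h' x v ≤ funkNorm x v) {σ : ℝ → unitBall n} {r : ℝ}
    (hσ : IsPiecewiseSmooth n σ r) :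
    h (σ r) - h (σ 0) ≤ curveLength (funkMetric n) σ r := by
  obtain ⟨k, t, ht, ht0, htk, hs⟩ := hσ
  have hp := fun i hi => intervalIntegrable_and_sub_le_integral hd hle (ht (Nat.le_succ i)) (hs i hi)
  rw [curveLength, ← ht0, ← htk,
    ← intervalIntegral.sum_integral_adjacent_intervals fun i hi => (hp i hi).1,
    ← Finset.sum_range_sub (fun i => h (σ (t i)))]
  exact Finset.sum_le_sum fun i hi => (hp i (Finset.mem_range.1 hi)).2

/-- The segment joins the points, so the set of lengths defining the distance is nonempty; the real
`sInf` of an empty set would be `0`. -/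
theorem exists_isPiecewiseSmooth (x y : unitBall n) :
    ∃ (σ : ℝ → unitBall n) (r : ℝ), IsPiecewiseSmooth n σ r ∧ σ 0 = x ∧ σ r = y := by
  have hmem : ∀ t ∈ Set.Icc (0 : ℝ) 1,
      AffineMap.lineMap (x : EuclideanSpace ℝ (Fin n)) (y : EuclideanSpace ℝ (Fin n)) t ∈
        unitBall n := fun t ht =>
    (convex_ball (0 : EuclideanSpace ℝ (Fin n)) 1).lineMap_mem x.2 y.2 ht
  classical
  set σ : ℝ → unitBall n := fun t => if h : t ∈ Set.Icc (0 : ℝ) 1 then ⟨_, hmem t h⟩ else x with hσ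
  have hcoe : ∀ t ∈ Set.Icc (0 : ℝ) 1, (σ t : EuclideanSpace ℝ (Fin n)) =
      AffineMap.lineMap (x : EuclideanSpace ℝ (Fin n)) (y : EuclideanSpace ℝ (Fin n)) t := by
    intro t ht
    simp only [hσ, dif_pos ht]
  refine ⟨σ, 1, ⟨1, fun i => min (i : ℝ) 1, ?_, by simp, by simp, ?_⟩, ?_, ?_⟩
  · intro i j hij
    exact min_le_min_right 1 (by exact_mod_cast hij)
  · intro i hi
    obtain rfl : i = 0 := by omega
    rw [contMDiffOn_unitBall_iff]
    simp only [Nat.cast_zero, zero_add, Nat.cast_one, min_self, zero_le_one, inf_of_le_left]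
    refine ContDiffOn.congr (ContDiff.contDiffOn ?_) fun t ht =>
      (hcoe t ht).trans (AffineMap.lineMap_apply_module' _ _ _)
    fun_prop
  · exact Subtype.ext (by rw [hcoe 0 (by simp), AffineMap.lineMap_apply_zero])
  · exact Subtype.ext (by rw [hcoe 1 (by simp), AffineMap.lineMap_apply_one])

/-- A function whose differential is bounded by the Funk norm is bounded by the Funk distance. -/
theorem sub_le_finslerDist {h : EuclideanSpace ℝ (Fin n) → ℝ}
    {h' : EuclideanSpace ℝ (Fin n) → EuclideanSpace ℝ (Fin n) →L[ℝ] ℝ}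
    (hd : ∀ x, ‖x‖ < 1 → HasFDerivAt h (h' x) x)
    (hle : ∀ x v, ‖x‖ < 1 → h' x v ≤ funkNorm x v) (x y : unitBall n) :
    h y - h x ≤ finslerDist (funkMetric n) x y := by
  obtain ⟨σ₀, r₀, h₀⟩ := exists_isPiecewiseSmooth x y
  refine le_csInf ⟨_, σ₀, r₀, h₀.1, h₀.2.1, h₀.2.2, rfl⟩ ?_
  rintro _ ⟨σ, r, hσ, rfl, rfl, rfl⟩
  exact sub_le_curveLength hd hle hσ

theorem finslerDist_funkMetric_nonneg (x y : unitBall n) :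
    0 ≤ finslerDist (funkMetric n) x y := by
  simpa using sub_le_finslerDist (h := fun _ => 0) (h' := fun _ => 0)
    (fun x _ => hasFDerivAt_const 0 x) (fun x v hx => by simpa using funkNorm_nonneg hx v) x y

/-- Calibrate with `½⟨w, ·⟩`, where `w` is the direction from `x` to `y`: `⟨w, v⟩ ≤ F (1 - ⟨w, x⟩) ≤
2F`. This makes Euclidean Lipschitz functions Lipschitz for the Funk distance. -/
theorem norm_sub_le_two_mul_finslerDist (x y : unitBall n) :
    ‖(y : EuclideanSpace ℝ (Fin n)) - x‖ ≤ 2 * finslerDist (funkMetric n) x y := by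
  set w : EuclideanSpace ℝ (Fin n) := ‖(y : EuclideanSpace ℝ (Fin n)) - x‖⁻¹ • (y - x) with hw
  have hw1 : ‖w‖ ≤ 1 := by
    rw [hw, norm_smul, norm_inv, norm_norm]
    exact inv_mul_le_one
  have h1 := sub_le_finslerDist (h := fun z => (1 / 2 : ℝ) * inner ℝ w z)
    (h' := fun _ => (1 / 2 : ℝ) • innerSL ℝ w)
    (fun x _ => ((innerSL ℝ w).hasFDerivAt (x := x)).const_mul (1 / 2)) (fun x v hx => by
      have h2 := inner_le_funkNorm_mul hx v hw1
      have h3 := abs_le.1 ((abs_real_inner_le_norm w x).trans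
        (mul_le_one₀ hw1 (norm_nonneg _) hx.le))
      have h4 := funkNorm_nonneg hx v
      simp only [smul_apply, innerSL_apply_apply, smul_eq_mul]
      nlinarith) x y
  have h5 : (inner ℝ w (y : EuclideanSpace ℝ (Fin n)) : ℝ) - inner ℝ w (x : EuclideanSpace ℝ (Fin n))
      = ‖(y : EuclideanSpace ℝ (Fin n)) - x‖ := by
    rw [← inner_sub_right, hw, inner_smul_left, real_inner_self_eq_norm_sq]
    rcases eq_or_ne ‖(y : EuclideanSpace ℝ (Fin n)) - x‖ 0 with h0 | h0
    · simp [h0]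
    · simp only [conj_trivial]
      field_simp
  linarith

/-- Calibrate with `-log(1 - ⟨w, ·⟩)`, `w = y / ‖y‖`, whose differential is bounded by `F` by the
supporting hyperplane inequality. The factor `1 - ‖x‖` expresses that outward motion near the
boundary is expensive; it is the decisive estimate for the eigenvalue. -/
theorem norm_sub_norm_le_finslerDist_mul (x y : unitBall n) :
    ‖(y : EuclideanSpace ℝ (Fin n))‖ - ‖(x : EuclideanSpace ℝ (Fin n))‖ ≤
      finslerDist (funkMetric n) x y * (1 - ‖(x : EuclideanSpace ℝ (Fin n))‖) := by
  set w : EuclideanSpace ℝ (Fin n) := ‖(y : EuclideanSpace ℝ (Fin n))‖⁻¹ • y with hw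
  have hw1 : ‖w‖ ≤ 1 := by
    rw [hw, norm_smul, norm_inv, norm_norm]
    exact inv_mul_le_one
  have hwx : ∀ x : EuclideanSpace ℝ (Fin n), inner ℝ w x ≤ ‖x‖ := fun x =>
    (real_inner_le_norm w x).trans (mul_le_of_le_one_left (norm_nonneg _) hw1)
  have hpos : ∀ x : EuclideanSpace ℝ (Fin n), ‖x‖ < 1 → 0 < 1 - (inner ℝ w x : ℝ) := fun x hx => by
    linarith [hwx x]
  have h1 := sub_le_finslerDist (h := fun z => -Real.log (1 - inner ℝ w z))
    (h' := fun x => -((1 - inner ℝ w x)⁻¹ • -innerSL ℝ w))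
    (fun x hx => ((((innerSL ℝ w).hasFDerivAt (x := x)).const_sub 1).log (hpos x hx).ne').neg)
    (fun x v hx => by
      simp only [neg_apply, smul_apply, innerSL_apply_apply, smul_eq_mul, mul_neg, neg_neg]
      rw [inv_mul_le_iff₀ (hpos x hx), mul_comm]
      exact inner_le_funkNorm_mul hx v hw1) x y
  have hwy : (inner ℝ w (y : EuclideanSpace ℝ (Fin n)) : ℝ) = ‖(y : EuclideanSpace ℝ (Fin n))‖ := by
    rw [hw, inner_smul_left, real_inner_self_eq_norm_sq]
    rcases eq_or_ne ‖(y : EuclideanSpace ℝ (Fin n))‖ 0 with h0 | h0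
    · simp [h0]
    · simp only [conj_trivial]
      field_simp
  have hx := hpos x (norm_coe_lt_one x)
  have hy := hpos y (norm_coe_lt_one y)
  have hxn := norm_coe_lt_one x
  -- `log s ≤ s - 1` replaces the logarithmic bound by a linear one, which is all that slopes
  -- require.
  have h2 := Real.log_le_sub_one_of_pos (div_pos hy hx)
  rw [Real.log_div hy.ne' hx.ne'] at h2
  have h3 := hwx x
  set d := finslerDist (funkMetric n) x y
  have hd : 0 ≤ d := finslerDist_funkMetric_nonneg x y
  have h4 : 1 - (1 - (inner ℝ w (y : EuclideanSpace ℝ (Fin n)) : ℝ)) /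
      (1 - inner ℝ w (x : EuclideanSpace ℝ (Fin n))) ≤ d := by linarith
  rw [hwy] at h4 hy
  have h5 : (1 - ‖(y : EuclideanSpace ℝ (Fin n))‖) /
      (1 - inner ℝ w (x : EuclideanSpace ℝ (Fin n))) ≤
      (1 - ‖(y : EuclideanSpace ℝ (Fin n))‖) / (1 - ‖(x : EuclideanSpace ℝ (Fin n))‖) :=
    div_le_div_of_nonneg_left hy.le (by linarith) (by linarith)
  have h6 : 1 - d ≤ (1 - ‖(y : EuclideanSpace ℝ (Fin n))‖) /
      (1 - ‖(x : EuclideanSpace ℝ (Fin n))‖) := by linarith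
  rw [le_div_iff₀ (by linarith)] at h6
  linarith

end Distance
-- The Busemann-Hausdorff measure
section Measure

variable {n : ℕ}

theorem measurableEmbedding_unitBall_coe :
    MeasurableEmbedding (Subtype.val : unitBall n → EuclideanSpace ℝ (Fin n)) :=
  (TopologicalSpace.Opens.isOpenEmbedding' (unitBall n)).measurableEmbedding

theorem unitBall_image_coe_preimage (S : Set (EuclideanSpace ℝ (Fin n))) :
    Subtype.val '' (Subtype.val ⁻¹' S : Set (unitBall n)) = Metric.ball 0 1 ∩ S :=
  Subtype.image_preimage_coe (Metric.ball (0 : EuclideanSpace ℝ (Fin n)) 1) S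

theorem bhDensity_funkMetric (p : unitBall n) {x : EuclideanSpace ℝ (Fin n)} (hx : ‖x‖ < 1) :
    bhDensity (funkMetric n) p x = 1 := by
  have h1 : {y | chartRep (funkMetric n) p x y < 1} =
      (fun y => x + y) ⁻¹' Metric.ball (0 : EuclideanSpace ℝ (Fin n)) 1 := by
    ext y
    simp only [Set.mem_ofPred_eq, chartRep_funkMetric p hx, funkNorm_lt_one_iff hx, Set.mem_preimage,
      mem_ball_zero_iff]
  rw [bhDensity, h1, MeasureTheory.measure_preimage_add]
  exact ENNReal.div_self (Metric.measure_ball_pos _ _ one_pos).ne'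
    MeasureTheory.measure_ball_lt_top.ne

/-- The Busemann-Hausdorff measure of the Funk metric is the Lebesgue measure. -/
theorem bhMeasure_funkMetric_apply (A : Set (unitBall n)) :
    bhMeasure (funkMetric n) A =
      MeasureTheory.volume ((Subtype.val : unitBall n → EuclideanSpace ℝ (Fin n)) '' A) := by
  have h1 : ∀ p : unitBall n, MeasureTheory.Measure.map (extChartAt (𝓡 n) p).symm
      ((MeasureTheory.volume.restrict (extChartAt (𝓡 n) p).target).withDensity
        (bhDensity (funkMetric n) p)) =
      MeasureTheory.Measure.comap (Subtype.val : unitBall n → EuclideanSpace ℝ (Fin n))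
        MeasureTheory.volume := by
    intro p
    have h2 : (MeasureTheory.volume.restrict (extChartAt (𝓡 n) p).target).withDensity
        (bhDensity (funkMetric n) p) =
          MeasureTheory.volume.restrict (extChartAt (𝓡 n) p).target := by
      rw [MeasureTheory.withDensity_congr_ae (g := 1), MeasureTheory.withDensity_one]
      filter_upwards [MeasureTheory.ae_restrict_mem (isOpen_extChartAt_target p).measurableSet]
        with x hx
      rw [extChartAt_unitBall_target, mem_ball_zero_iff] at hx
      exact bhDensity_funkMetric p hx
    rw [h2]
    ext B hB
    rw [MeasureTheory.Measure.map_apply_of_aemeasurable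
        ((continuousOn_extChartAt_symm p).aemeasurable (isOpen_extChartAt_target p).measurableSet) hB,
      MeasureTheory.Measure.restrict_apply' (isOpen_extChartAt_target p).measurableSet]
    refine Eq.trans (congrArg _ ?_)
      (measurableEmbedding_unitBall_coe.comap_apply MeasureTheory.volume B).symm
    ext x
    rw [extChartAt_unitBall_target]
    constructor
    · rintro ⟨hxB, hx⟩
      exact ⟨_, hxB, coe_extChartAt_unitBall_symm p (mem_ball_zero_iff.1 hx)⟩
    · rintro ⟨q, hq, rfl⟩
      refine ⟨?_, q.2⟩
      rw [Set.mem_preimage]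
      convert hq
      exact Subtype.ext (coe_extChartAt_unitBall_symm p (norm_coe_lt_one q))
  -- By `h1` the supremum is over a constant family, equal to its value once the index set is
  -- nonempty.
  have : Nonempty (unitBall n) := ⟨⟨0, by simp [mem_unitBall]⟩⟩
  simp only [bhMeasure, h1, ciSup_const]
  exact measurableEmbedding_unitBall_coe.comap_apply _ _

end Measure

/-! ### Test functions and the vanishing of the first eigenvalue -/

section Eigenvalue

variable {n : ℕ}

/-- Move outwards along the ray through `x`, or along any ray when `x = 0`. Such points give a
nonnegative limsup for radially increasing functions and show that the punctured neighbourhood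
filter is nontrivial. -/
theorem frequently_norm_le (hn : 0 < n) (x : unitBall n) :
    ∃ᶠ y : unitBall n in 𝓝[≠] x, ‖(x : EuclideanSpace ℝ (Fin n))‖ ≤ ‖(y : EuclideanSpace ℝ (Fin n))‖ := by
  have hx := norm_coe_lt_one x
  obtain ⟨w, hw, hxw⟩ : ∃ w : EuclideanSpace ℝ (Fin n), ‖w‖ = 1 ∧
      SameRay ℝ (x : EuclideanSpace ℝ (Fin n)) w := by
    rcases eq_or_ne (x : EuclideanSpace ℝ (Fin n)) 0 with h0 | h0
    · exact ⟨EuclideanSpace.single ⟨0, hn⟩ 1, by simp, by simp [h0]⟩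
    · refine ⟨‖(x : EuclideanSpace ℝ (Fin n))‖⁻¹ • (x : EuclideanSpace ℝ (Fin n)), ?_, ?_⟩
      · rw [norm_smul, norm_inv, norm_norm, inv_mul_cancel₀ (norm_ne_zero_iff.2 h0)]
      · exact SameRay.sameRay_nonneg_smul_right _ (by positivity)
  rw [(Metric.nhdsWithin_basis_ball (x := x)).frequently_iff]
  intro ε hε
  set δ := min (ε / 2) ((1 - ‖(x : EuclideanSpace ℝ (Fin n))‖) / 2) with hδ
  have hδ0 : 0 < δ := lt_min (by linarith) (by linarith)
  have hδw : ‖δ • w‖ = δ := by rw [norm_smul, hw, Real.norm_of_nonneg hδ0.le, mul_one]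
  have hnorm : ‖(x : EuclideanSpace ℝ (Fin n)) + δ • w‖ = ‖(x : EuclideanSpace ℝ (Fin n))‖ + δ := by
    rw [(hxw.nonneg_smul_right hδ0.le).norm_add, hδw]
  have hmem : (x : EuclideanSpace ℝ (Fin n)) + δ • w ∈ unitBall n := by
    rw [mem_unitBall, hnorm]
    linarith [min_le_right (ε / 2) ((1 - ‖(x : EuclideanSpace ℝ (Fin n))‖) / 2)]
  refine ⟨⟨_, hmem⟩, ⟨?_, fun h => ?_⟩, ?_⟩
  · rw [Metric.mem_ball, Subtype.dist_eq, dist_eq_norm, add_sub_cancel_left, hδw]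
    linarith [min_le_left (ε / 2) ((1 - ‖(x : EuclideanSpace ℝ (Fin n))‖) / 2)]
  · have h1 := congrArg (fun z : unitBall n => ‖(z : EuclideanSpace ℝ (Fin n))‖) h
    simp only [hnorm] at h1
    linarith
  · rw [hnorm]
    linarith

/-- The profile which is `-1` on `(-∞, ρ]`, `0` on `[(1 + ρ) / 2, ∞)` and affine in between. -/
noncomputable def cutoff (ρ s : ℝ) : ℝ := max (-1) (min 0 ((s - (1 + ρ) / 2) * (2 / (1 - ρ))))

section Cutoff

variable {ρ s t : ℝ}

theorem cutoff_mono (hρ : ρ < 1) : Monotone (cutoff ρ) := by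
  intro s t hst
  have : 0 ≤ 2 / (1 - ρ) := by
    have : 0 < 1 - ρ := by linarith
    positivity
  unfold cutoff
  gcongr

theorem cutoff_sub_le (hρ : ρ < 1) (hst : s ≤ t) :
    cutoff ρ t - cutoff ρ s ≤ 2 / (1 - ρ) * (t - s) := by
  have h : 0 ≤ 2 / (1 - ρ) := by
    have : 0 < 1 - ρ := by linarith
    positivity
  unfold cutoff
  have h1 := mul_le_mul_of_nonneg_left hst h
  rcases max_cases (-1) (min 0 ((t - (1 + ρ) / 2) * (2 / (1 - ρ)))) with ⟨h1, _⟩ | ⟨h1, _⟩ <;>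
  rcases max_cases (-1) (min 0 ((s - (1 + ρ) / 2) * (2 / (1 - ρ)))) with ⟨h2, _⟩ | ⟨h2, _⟩ <;>
  rcases min_cases 0 ((t - (1 + ρ) / 2) * (2 / (1 - ρ))) with ⟨h3, _⟩ | ⟨h3, _⟩ <;>
  rcases min_cases 0 ((s - (1 + ρ) / 2) * (2 / (1 - ρ))) with ⟨h4, _⟩ | ⟨h4, _⟩ <;>
  rw [h1, h2] <;> linarith

theorem abs_cutoff_sub_le (hρ : ρ < 1) : |cutoff ρ s - cutoff ρ t| ≤ 2 / (1 - ρ) * |s - t| := by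
  rcases le_total s t with h | h
  · rw [abs_sub_comm, abs_sub_comm s t, abs_of_nonneg (sub_nonneg.2 (cutoff_mono hρ h)),
      abs_of_nonneg (sub_nonneg.2 h)]
    exact cutoff_sub_le hρ h
  · rw [abs_of_nonneg (sub_nonneg.2 (cutoff_mono hρ h)), abs_of_nonneg (sub_nonneg.2 h)]
    exact cutoff_sub_le hρ h

theorem cutoff_of_le (hρ : ρ < 1) (hs : s ≤ ρ) : cutoff ρ s = -1 := by
  have h : 0 < 1 - ρ := by linarith
  have h1 : (s - (1 + ρ) / 2) * (2 / (1 - ρ)) ≤ -1 := by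
    rw [mul_div_assoc', div_le_iff₀ h]
    linarith
  exact max_eq_left ((min_le_right _ _).trans h1)

theorem cutoff_of_ge (hρ : ρ < 1) (hs : (1 + ρ) / 2 ≤ s) : cutoff ρ s = 0 := by
  have h : 0 < 1 - ρ := by linarith
  have h1 : 0 ≤ (s - (1 + ρ) / 2) * (2 / (1 - ρ)) := mul_nonneg (by linarith) (by positivity)
  rw [cutoff, min_eq_left h1]
  norm_num

end Cutoff

theorem isLipZero_cutoff {ρ : ℝ} (hρ : ρ < 1) :
    IsLipZero (finslerDist (funkMetric n))
      fun x : unitBall n => cutoff ρ ‖(x : EuclideanSpace ℝ (Fin n))‖ := by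
  have h : 0 < 1 - ρ := by linarith
  refine ⟨⟨2 / (1 - ρ) * 2, fun x y => ?_⟩, ?_⟩
  · refine (abs_cutoff_sub_le hρ).trans ?_
    rw [mul_assoc]
    refine mul_le_mul_of_nonneg_left ?_ (by positivity)
    refine (abs_norm_sub_norm_le _ _).trans ?_
    rw [norm_sub_rev]
    exact norm_sub_le_two_mul_finslerDist x y
  · refine HasCompactSupport.intro (K := Subtype.val ⁻¹' Metric.closedBall 0 ((1 + ρ) / 2)) ?_ ?_
    · refine (TopologicalSpace.Opens.isOpenEmbedding' (unitBall n)).isInducing.isCompact_preimage'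
        (isCompact_closedBall _ _) ?_
      intro x hx
      have := mem_closedBall_zero_iff.1 hx
      exact ⟨⟨x, mem_unitBall.2 (by linarith)⟩, rfl⟩
    · intro x hx
      refine cutoff_of_ge hρ (le_of_lt ?_)
      simpa using hx

theorem slopeAt_cutoff_of_lt {ρ : ℝ} (hn : 0 < n) (hρ : ρ < 1) {x : unitBall n}
    (hx : ‖(x : EuclideanSpace ℝ (Fin n))‖ < ρ) :
    slopeAt (finslerDist (funkMetric n))
      (fun x : unitBall n => cutoff ρ ‖(x : EuclideanSpace ℝ (Fin n))‖) x = 0 := by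
  have hne : (𝓝[≠] x).NeBot := Filter.frequently_true_iff_neBot _ |>.1
    ((frequently_norm_le hn x).mono fun _ _ => trivial)
  have hev : ∀ᶠ y : unitBall n in 𝓝[≠] x, ‖(y : EuclideanSpace ℝ (Fin n))‖ < ρ :=
    nhdsWithin_le_nhds ((continuous_subtype_val.norm.isOpen_preimage _ isOpen_Iio).mem_nhds hx)
  rw [slopeAt, Filter.limsup_congr (v := fun _ => 0), Filter.limsup_const]
  filter_upwards [hev] with y hy
  rw [cutoff_of_le hρ hy.le, cutoff_of_le hρ hx.le, sub_self, zero_div]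

/-- The bound does not depend on `ρ`: the steepness `2 / (1 - ρ)` of the profile is compensated by
the factor `1 - ‖x‖ ≤ 1 - ρ` in the distance estimate. -/
theorem slopeAt_cutoff_mem {ρ : ℝ} (hn : 0 < n) (hρ : ρ < 1) {x : unitBall n}
    (hx : ρ ≤ ‖(x : EuclideanSpace ℝ (Fin n))‖) :
    slopeAt (finslerDist (funkMetric n))
      (fun x : unitBall n => cutoff ρ ‖(x : EuclideanSpace ℝ (Fin n))‖) x ∈ Set.Icc 0 2 := by
  have h : 0 < 1 - ρ := by linarith
  have hle : ∀ y : unitBall n, (cutoff ρ ‖(y : EuclideanSpace ℝ (Fin n))‖ -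
      cutoff ρ ‖(x : EuclideanSpace ℝ (Fin n))‖) / finslerDist (funkMetric n) x y ≤ 2 := by
    intro y
    have hd := finslerDist_funkMetric_nonneg x y
    refine div_le_of_le_mul₀ hd (by norm_num) ?_
    -- Inward the function does not increase, so the quotient is at most `0`; only outward points
    -- need the distance estimate.
    rcases le_total ‖(y : EuclideanSpace ℝ (Fin n))‖ ‖(x : EuclideanSpace ℝ (Fin n))‖ with hyx | hyx
    · linarith [cutoff_mono hρ hyx]
    · refine (cutoff_sub_le hρ hyx).trans ?_
      rw [div_mul_eq_mul_div, div_le_iff₀ h]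
      have h1 := norm_sub_norm_le_finslerDist_mul x y
      have h2 : finslerDist (funkMetric n) x y * (1 - ‖(x : EuclideanSpace ℝ (Fin n))‖) ≤
          finslerDist (funkMetric n) x y * (1 - ρ) :=
        mul_le_mul_of_nonneg_left (by linarith) hd
      linarith
  have hfr : ∃ᶠ y : unitBall n in 𝓝[≠] x, 0 ≤ (cutoff ρ ‖(y : EuclideanSpace ℝ (Fin n))‖ -
      cutoff ρ ‖(x : EuclideanSpace ℝ (Fin n))‖) / finslerDist (funkMetric n) x y :=
    (frequently_norm_le hn x).mono fun y hy =>
      div_nonneg (sub_nonneg.2 (cutoff_mono hρ hy)) (finslerDist_funkMetric_nonneg x y)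
  refine ⟨Filter.le_limsup_of_frequently_le hfr
    (Filter.isBoundedUnder_of ⟨2, hle⟩), ?_⟩
  exact Filter.limsup_le_of_le (Filter.IsCobounded.of_frequently_ge hfr)
    (Filter.Eventually.of_forall hle)

/-- The Rayleigh quotient of the cutoff: the squared slope is at most `4` and vanishes on `ρB`,
while the function is `-1` on `B / 2`, because `ρ ≥ 1/2`. -/
theorem firstEigenvalue_funkMetric_le (hn : 0 < n) {ρ : ℝ} (hρ : ρ < 1) (hρ2 : 1 / 2 ≤ ρ) :
    firstEigenvalue (finslerDist (funkMetric n)) (bhMeasure (funkMetric n)) ≤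
      4 * MeasureTheory.volume (Metric.ball (0 : EuclideanSpace ℝ (Fin n)) 1 \ Metric.ball 0 ρ) /
        MeasureTheory.volume (Metric.ball (0 : EuclideanSpace ℝ (Fin n)) (1 / 2)) := by
  set μ := bhMeasure (funkMetric n)
  refine (iInf₂_le_of_le _ (isLipZero_cutoff hρ) (iInf_le_of_le ?_ le_rfl)).trans
    (ENNReal.div_le_div ?_ ?_)
  · intro h0
    have h1 := congrFun h0 ⟨0, by simp [mem_unitBall]⟩
    simp only [norm_zero, Pi.zero_apply] at h1
    rw [cutoff_of_le hρ (by linarith)] at h1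
    norm_num at h1
  · set A : Set (unitBall n) := Subtype.val ⁻¹' (Metric.ball 0 ρ)ᶜ with hA
    have hAm : MeasurableSet A := measurable_subtype_coe measurableSet_ball.compl
    have h1 : μ A = MeasureTheory.volume
        (Metric.ball (0 : EuclideanSpace ℝ (Fin n)) 1 \ Metric.ball 0 ρ) := by
      rw [bhMeasure_funkMetric_apply, hA, unitBall_image_coe_preimage]
      rfl
    rw [← h1, ← MeasureTheory.lintegral_indicator_const hAm]
    refine MeasureTheory.lintegral_mono fun x => ?_
    by_cases hx : ‖(x : EuclideanSpace ℝ (Fin n))‖ < ρ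
    · rw [slopeAt_cutoff_of_lt hn hρ hx]
      simp
    · have hxA : x ∈ A := by simpa [hA] using hx
      rw [Set.indicator_of_mem hxA]
      have h2 := slopeAt_cutoff_mem hn hρ (not_lt.1 hx)
      refine ENNReal.ofReal_le_of_le_toReal ?_
      have h3 := pow_le_pow_left₀ h2.1 h2.2 2
      norm_num at h3 ⊢
      exact h3
  · set B : Set (unitBall n) := Subtype.val ⁻¹' (Metric.ball 0 (1 / 2)) with hB
    have hBm : MeasurableSet B := measurable_subtype_coe measurableSet_ball
    have h1 : μ B = MeasureTheory.volume
        (Metric.ball (0 : EuclideanSpace ℝ (Fin n)) (1 / 2)) := by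
      rw [bhMeasure_funkMetric_apply, hB, unitBall_image_coe_preimage]
      exact congrArg _ (Set.inter_eq_self_of_subset_right (Metric.ball_subset_ball (by norm_num)))
    rw [← h1, ← MeasureTheory.lintegral_indicator_one hBm]
    refine MeasureTheory.lintegral_mono fun x => ?_
    by_cases hx : x ∈ B
    · have : ‖(x : EuclideanSpace ℝ (Fin n))‖ < 1 / 2 := by simpa [hB] using hx
      rw [Set.indicator_of_mem hx]
      simp only [cutoff_of_le hρ (this.le.trans hρ2)]
      simp
    · rw [Set.indicator_of_notMem hx]
      exact zero_le

theorem firstEigenvalue_funkMetric (hn : 0 < n) :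
    firstEigenvalue (finslerDist (funkMetric n)) (bhMeasure (funkMetric n)) = 0 := by
  -- The shift by `2` makes the sequence start at `1/2`, as the Rayleigh quotient bound demands.
  set ρ : ℕ → ℝ := fun m => 1 - 1 / ((m : ℝ) + 2) with hρ
  have hmono : Monotone ρ := fun i j hij => by
    have : (i : ℝ) ≤ j := by exact_mod_cast hij
    simp only [hρ]
    gcongr
  have hlt : ∀ m, ρ m < 1 := fun m => by
    have : 0 < 1 / ((m : ℝ) + 2) := by positivity
    simp only [hρ]
    linarith
  have hge : ∀ m, 1 / 2 ≤ ρ m := fun m => by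
    have : 1 / ((m : ℝ) + 2) ≤ 1 / 2 := one_div_le_one_div_of_le (by norm_num) (by simp)
    simp only [hρ]
    linarith
  have hlim : Filter.Tendsto ρ Filter.atTop (𝓝 1) := by
    have h1 := (tendsto_one_div_add_atTop_nhds_zero_nat (𝕜 := ℝ)).comp (Filter.tendsto_add_atTop_nat 1)
    have h2 := h1.const_sub 1
    rw [sub_zero] at h2
    refine h2.congr fun m => ?_
    simp only [hρ, Function.comp_apply]
    push_cast
    ring
  have hinter : ⋂ m, (Metric.ball (0 : EuclideanSpace ℝ (Fin n)) 1 \ Metric.ball 0 (ρ m)) = ∅ := by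
    rw [Set.eq_empty_iff_forall_notMem]
    intro x hx
    rw [Set.mem_iInter] at hx
    have h1 : 1 ≤ ‖x‖ := le_of_tendsto' hlim fun m => by simpa using (hx m).2
    have h2 := mem_ball_zero_iff.1 (hx 0).1
    linarith
  have hvol := MeasureTheory.tendsto_measure_iInter_atTop
    (μ := (MeasureTheory.volume : MeasureTheory.Measure (EuclideanSpace ℝ (Fin n))))
    (s := fun m => Metric.ball (0 : EuclideanSpace ℝ (Fin n)) 1 \ Metric.ball 0 (ρ m))
    (fun m => (measurableSet_ball.diff measurableSet_ball).nullMeasurableSet)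
    (fun i j hij => Set.sdiff_subset_sdiff_right (Metric.ball_subset_ball (hmono hij)))
    ⟨0, (MeasureTheory.measure_mono Set.sdiff_subset |>.trans_lt
      MeasureTheory.measure_ball_lt_top).ne⟩
  rw [hinter, MeasureTheory.measure_empty] at hvol
  have h3 := ENNReal.Tendsto.div_const (ENNReal.Tendsto.const_mul (a := 4) hvol (Or.inr (by simp)))
    (b := MeasureTheory.volume (Metric.ball (0 : EuclideanSpace ℝ (Fin n)) (1 / 2)))
    (Or.inr (Metric.measure_ball_pos _ _ (by norm_num)).ne')
  rw [mul_zero, ENNReal.zero_div] at h3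
  exact le_antisymm (ge_of_tendsto' h3 fun m =>
    firstEigenvalue_funkMetric_le hn (hlt m) (hge m)) (zero_le)

end Eigenvalue
end Finsler

theorem theorem1p3 (n : ℕ) (hn : 2 ≤ n) :
    (∃ (M : Type) (_ : TopologicalSpace M) (_ : T2Space M) (_ : SecondCountableTopology M)
        (_ : MeasurableSpace M) (_ : BorelSpace M)
        (_ : ChartedSpace (EuclideanSpace ℝ (Fin n)) M) (_ : IsManifold (𝓡 n) ∞ M)
        (F : TangentBundle (𝓡 n) M → ℝ),
      Finsler.IsFinslerMetric F ∧ NoncompactSpace M ∧ Finsler.ForwardComplete F ∧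
        SimplyConnectedSpace M ∧
        (∃ K : ℝ, K < 0 ∧ Finsler.HasConstantFlagCurvature F K) ∧
        Finsler.firstEigenvalue (Finsler.finslerDist F) (Finsler.bhMeasure F) = 0) ∧
    (Finsler.IsFinslerMetric (Finsler.funkMetric n) ∧
      NoncompactSpace (Finsler.unitBall n) ∧
      Finsler.ForwardComplete (Finsler.funkMetric n) ∧
      SimplyConnectedSpace (Finsler.unitBall n) ∧
      Finsler.HasConstantFlagCurvature (Finsler.funkMetric n) (-1 / 4) ∧
      Finsler.firstEigenvalue (Finsler.finslerDist (Finsler.funkMetric n))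
        (Finsler.bhMeasure (Finsler.funkMetric n)) = 0) := by
  have hF := Finsler.isFinslerMetric_funkMetric (n := n)
  have hN := Finsler.noncompactSpace_unitBall hn
  have hC := Finsler.forwardComplete_funkMetric (n := n)
  have hS := Finsler.simplyConnectedSpace_unitBall (n := n)
  have hK := Finsler.hasConstantFlagCurvature_funkMetric (n := n)
  have hE := Finsler.firstEigenvalue_funkMetric (n := n) (by omega)
  refine ⟨⟨Finsler.unitBall n, inferInstance, inferInstance, inferInstance, inferInstance,
    inferInstance, inferInstance, inferInstance, Finsler.funkMetric n, hF, hN, hC, hS,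
    ⟨-1 / 4, by norm_num, hK⟩, hE⟩, hF, hN, hC, hS, hK, hE⟩
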